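/- Let $r\ge 1$, $0=\zeta_{-1}<\zeta_0<\dots<\zeta_r=1$, $0=\gamma_0<\gamma_1<\dots<\gamma_r<\infty$, and let $P_h$ be a compactly supported probability measure on $\mathbb R$. For $k\ge r$ let $\mathcal M_k$ be the set of pairs $(x,\xi)$ of sequences with $0=x_0\le x_1\le\dots\le x_{k+1}=1$ and $0\le\xi_0\le\dots\le\xi_k=\xi_{k+1}=1$ such that every $\zeta_0,\dots,\zeta_r$ occurs among the $\xi_j$; put $\mathcal M=\bigcup_{k\ge r}\mathcal M_k$. Set $\xi_{-1}=0$, and $\tilde\gamma_j=\gamma_\ell$ if $\zeta_{\ell-1}<\xi_j\le\zeta_\ell$ (and $\tilde\gamma_j=0$ if $\xi_j=0$). With $\eta_1,\dots,\eta_{k+1}$ i.i.d. standard Gaussian, independent of $h\sim P_h$, let $$\tilde Z_{k+1}=2\cosh\Big(h+\sqrt2\sum_{j=1}^{k+1}\eta_j\sqrt{\tilde\gamma_j^2x_j-\tilde\gamma_{j-1}^2x_{j-1}}\Big),\qquad \tilde Z_{j-1}^{\xi_{j-1}}=\mathbb E_{\eta_j}\tilde Z_j^{\xi_{j-1}}\quad(1\le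 j\le k+1)$$ (for $\xi_{j-1}=0$ this means $\log\tilde Z_{j-1}=\mathbb E_{\eta_j}\log\tilde Z_j$), and define the Parisi functional $$\mathcal P(x,\xi)=\mathbb E_h\log\tilde Z_0-\frac12\sum_{j=0}^k\xi_j\big((\tilde\gamma_{j+1}x_{j+1})^2-(\tilde\gamma_jx_j)^2\big).$$ A pair in $\mathcal M_k$ is called $k$-stationary if it minimizes $\mathcal P$ over $\mathcal M_k$; its associated measure is $\sum_{j=0}^k(\xi_j-\xi_{j-1})\delta_{x_j}$. For a probability measure $\mu$ on $[0,1]$ let $\mu^{-1}(p)=\inf\{s\in[0,1]:\mu([0,s])\ge p\}$ and $\mu^{-1}(p^+)=\lim_{q\downarrow p}\mu^{-1}(q)$, and let $W_1(\mu,\nu)=\int_0^1|\mu^{-1}(p)-\nu^{-1}(p)|\,dp$. A measure $\mu$ with finitely many atoms $0=y_0<\dots<y_{k'}<1$ and cumulative weights $0<m_0<\dots<m_{k'}=1$ is mapped to the pair $(x^\mu,\xi^\mu)\in\mathcal M$ in which $\xi^\mu$ lists $\{m_i\}\cup\{\zeta_\ell\}$ increasingly, followed by $1$, and $x^\mu_j=\mu^{-1}(\xi^\mu_j)$,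 followed by $1$. Let $\bar{\mathcal P}$ be the $W_1$-continuous extension of $\mu\mapsto\mathcal P(x^\mu,\xi^\mu)$ to all probability measures on $[0,1]$. Let $\mu^*$ be a minimizer of $\bar{\mathcal P}$ that is the $W_1$-limit of measures $\mu_n$ associated with $k_n$-stationary pairs, and let $1\le\ell\le r-1$ with $\zeta_\ell\gamma_{\ell+1}^2<\frac12$. Write $a=(\mu^*)^{-1}(\zeta_\ell)$ and $b=(\mu^*)^{-1}(\zeta_\ell^+)$. Then the quantile jump $\Delta_\ell(\mu^*)=b-a$ satisfies $$\Delta_\ell(\mu^*)\ \ge\ C:=2\,(\gamma_{\ell+1}^2-\gamma_\ell^2)\;a\,\Big(\int_b^1\mu^*([0,x])\,dx\Big)^2 .$$ Moreover the distribution function satisfies $\mu^*([0,x])=\zeta_\ell$ for all $x\in[a,b)$; one has $C>0$ whenever $a>0$ and $b<1$; and if $C>0$, then $a<b$, both $a$ and $b$ belong to the support of $\mu^*$, and $\mu^*((a,b))=0$, i.e. the distribution function has a plateau at height $\zeta_\ell$ of length at least $C$ and the support of $\mu^*$ has the gap $(a,b)$. -/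

import Mathlib

open MeasureTheory Filter Topology Set

noncomputable section

/-! ### Probability measures on `[0,1]`, quantiles, and the distance `W₁` -/

/-- Probability measures supported on `[0,1]`. -/
def Pr01 : Set (Measure ℝ) := {μ | IsProbabilityMeasure μ ∧ μ (Icc 0 1)ᶜ = 0}

/-- The quantile function `μ⁻¹(p) = inf {s ∈ [0,1] : μ([0,s]) ≥ p}`, for `p ∈ [0,1]`. -/
def quantile (μ : Measure ℝ) (p : ℝ) : ℝ :=
  sInf {s : ℝ | s ∈ Icc (0 : ℝ) 1 ∧ p ≤ μ.real (Icc 0 s)}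

/-- The right limit `μ⁻¹(p⁺)` of the quantile function. -/
def quantileRight (μ : Measure ℝ) (p : ℝ) : ℝ := Function.rightLim (quantile μ) p

/-- `W₁(μ, ν) = ∫₀¹ |μ⁻¹(p) - ν⁻¹(p)| dp`. -/
def W1 (μ ν : Measure ℝ) : ℝ := ∫ p in (0 : ℝ)..1, |quantile μ p - quantile ν p|

/-- The previous value of a sequence, with the value at index `-1` equal to `0`. -/
def prevVal (a : ℕ → ℝ) : ℕ → ℝ
  | 0 => 0
  | j + 1 => a j

/-- The law `∑_{j ≤ k} (m_j - m_{j-1}) δ_{y_j}`, with `m_{-1} = 0`. -/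
def stepLaw (k : ℕ) (y m : ℕ → ℝ) : Measure ℝ :=
  ∑ j ∈ Finset.range (k + 1), ENNReal.ofReal (m j - prevVal m j) • Measure.dirac (y j)

/-- A probability measure with `k + 1` atoms in `[0,1)`, the first one at `0`, given by its atoms
`0 = y_0 < ⋯ < y_k < 1` and its cumulative weights `0 < m_0 < ⋯ < m_k = 1`. -/
structure DiscreteLaw where
  k : ℕ
  y : ℕ → ℝ
  m : ℕ → ℝ
  y_zero : y 0 = 0
  y_lt : ∀ j < k, y j < y (j + 1)
  y_last : y k < 1
  m_zero : 0 < m 0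
  m_lt : ∀ j < k, m j < m (j + 1)
  m_last : m k = 1

/-- The measure described by a `DiscreteLaw`. -/
def DiscreteLaw.law (d : DiscreteLaw) : Measure ℝ := stepLaw d.k d.y d.m

/-! ### The multiscale Sherrington-Kirkpatrick model and its Parisi functional -/

/-- The data of the multiscale SK model: the number of scales `r ≥ 1`, the sequences
`0 = ζ_{-1} < ζ_0 < ⋯ < ζ_r = 1` and `0 = γ_0 < γ_1 < ⋯ < γ_r`, and the law of the external
field, which is compactly supported. -/
structure MultiscaleSK where
  r : ℕ
  ζ : ℕ → ℝ
  γ : ℕ → ℝ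
  fieldLaw : Measure ℝ
  one_le_r : 1 ≤ r
  ζ_zero_pos : 0 < ζ 0
  ζ_lt : ∀ ℓ < r, ζ ℓ < ζ (ℓ + 1)
  ζ_last : ζ r = 1
  γ_zero : γ 0 = 0
  γ_lt : ∀ ℓ < r, γ ℓ < γ (ℓ + 1)
  fieldLaw_prob : IsProbabilityMeasure fieldLaw
  fieldLaw_compact : ∃ K : Set ℝ, IsCompact K ∧ fieldLaw Kᶜ = 0

namespace MultiscaleSK

/-- `(x, ξ) ∈ 𝓜_k`. Only the entries `x_0, …, x_{k+1}` and `ξ_0, …, ξ_{k+1}` matter. -/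
structure IsPair (M : MultiscaleSK) (k : ℕ) (x ξ : ℕ → ℝ) : Prop where
  ξ_nonneg : 0 ≤ ξ 0
  ξ_le : ∀ j ≤ k, ξ j ≤ ξ (j + 1)
  ξ_k : ξ k = 1
  ξ_last : ξ (k + 1) = 1
  x_zero : x 0 = 0
  x_le : ∀ j ≤ k, x j ≤ x (j + 1)
  x_last : x (k + 1) = 1
  ζ_mem : ∀ ℓ ≤ M.r, ∃ j ≤ k + 1, ξ j = M.ζ ℓ

/-- The value of `γ̃_j` when `ξ_j = t`: it is `γ_ℓ` for the unique `ℓ ∈ {0, …, r}` with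
`ζ_{ℓ-1} < t ≤ ζ_ℓ`, and `0` when `t = 0`. -/
def gammaTilde (M : MultiscaleSK) (t : ℝ) : ℝ :=
  ∑ ℓ ∈ Finset.range (M.r + 1), if prevVal M.ζ ℓ < t ∧ t ≤ M.ζ ℓ then M.γ ℓ else 0

/-- The coefficient of `η_{j+1}` in the one-body Hamiltonian,
`√2 √(γ̃_{j+1}² x_{j+1} - γ̃_j² x_j)`. -/
def coef (M : MultiscaleSK) (x ξ : ℕ → ℝ) (j : ℕ) : ℝ :=
  √2 * √(M.gammaTilde (ξ (j + 1)) ^ 2 * x (j + 1) - M.gammaTilde (ξ j) ^ 2 * x j)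

/-- One step `Z ↦ (𝔼_η Z(· + c η)^t)^{1/t}` of the recursion, `η` standard Gaussian; for `t = 0`
it is the limit `exp (𝔼_η log Z(· + c η))`. -/
def gaussStep (t c : ℝ) (Z : ℝ → ℝ) (u : ℝ) : ℝ :=
  if t = 0 then Real.exp (∫ η, Real.log (Z (u + c * η)) ∂ProbabilityTheory.gaussianReal 0 1)
  else (∫ η, Z (u + c * η) ^ t ∂ProbabilityTheory.gaussianReal 0 1) ^ (1 / t)

/-- `Zrec k x ξ m` is `Z̃_{k+1-m}`. The random variable `Z̃_j` depends on `η_1, …, η_j` and on the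
field `h` only through `u = h + ∑_{p ≤ j} η_p √2 √(γ̃_p² x_p - γ̃_{p-1}² x_{p-1})`, and is written
as a function of `u`. -/
def Zrec (M : MultiscaleSK) (k : ℕ) (x ξ : ℕ → ℝ) : ℕ → ℝ → ℝ
  | 0 => fun u => 2 * Real.cosh u
  | m + 1 => gaussStep (ξ (k - m)) (M.coef x ξ (k - m)) (Zrec M k x ξ m)

/-- The Parisi functional `𝓟(x, ξ)`, averaged over the external field. -/
def parisi (M : MultiscaleSK) (k : ℕ) (x ξ : ℕ → ℝ) : ℝ :=
  (∫ h, Real.log (M.Zrec k x ξ (k + 1) h) ∂M.fieldLaw)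
    - 1 / 2 * ∑ j ∈ Finset.range (k + 1),
        ξ j * ((M.gammaTilde (ξ (j + 1)) * x (j + 1)) ^ 2 - (M.gammaTilde (ξ j) * x j) ^ 2)

/-- A `k`-stationary pair: a minimizer of the Parisi functional over `𝓜_k`. -/
def IsStationaryPair (M : MultiscaleSK) (k : ℕ) (x ξ : ℕ → ℝ) : Prop :=
  M.IsPair k x ξ ∧ ∀ x' ξ' : ℕ → ℝ, M.IsPair k x' ξ' → M.parisi k x ξ ≤ M.parisi k x' ξ'

/-- The set `m ∪ ζ` of a discrete law. -/
def levels (M : MultiscaleSK) (d : DiscreteLaw) : Finset ℝ :=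
  (Finset.range (d.k + 1)).image d.m ∪ (Finset.range (M.r + 1)).image M.ζ

/-- The sequence `ξ^μ`: the set `m ∪ ζ` in increasing order, followed by `1`. -/
def xiOf (M : MultiscaleSK) (d : DiscreteLaw) (j : ℕ) : ℝ :=
  ((M.levels d).sort (· ≤ ·)).getD j 1

/-- The sequence `x^μ`: `x^μ_j = μ⁻¹(ξ^μ_j)` for the indices of `m ∪ ζ`, followed by `1`. -/
def xOf (M : MultiscaleSK) (d : DiscreteLaw) (j : ℕ) : ℝ :=
  if j < (M.levels d).card then quantile d.law (M.xiOf d j) else 1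

/-- The Parisi functional of a discrete measure, `𝓟(x^μ, ξ^μ)`. -/
def parisiDiscrete (M : MultiscaleSK) (d : DiscreteLaw) : ℝ :=
  M.parisi ((M.levels d).card - 1) (M.xOf d) (M.xiOf d)

/-- The Parisi functional of a probability measure on `[0,1]`: the extension of `parisiDiscrete`
by `W₁`-continuity. -/
def parisiBar (M : MultiscaleSK) (μ : Measure ℝ) : ℝ :=
  limUnder (comap (fun d : DiscreteLaw => W1 d.law μ) (𝓝 0)) M.parisiDiscrete

/-- A Parisi measure: a minimizer of the Parisi functional over the probability measures on
`[0,1]`. -/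
def IsParisiMeasure (M : MultiscaleSK) (μ : Measure ℝ) : Prop :=
  μ ∈ Pr01 ∧ ∀ ν ∈ Pr01, M.parisiBar μ ≤ M.parisiBar ν

/-- The quantile jump `Δ_ℓ(μ) = μ⁻¹(ζ_ℓ⁺) - μ⁻¹(ζ_ℓ)`. -/
def quantileJump (M : MultiscaleSK) (ℓ : ℕ) (μ : Measure ℝ) : ℝ :=
  quantileRight μ (M.ζ ℓ) - quantile μ (M.ζ ℓ)

/-- The quantity
`2 (γ_{ℓ+1}² - γ_ℓ²) μ⁻¹(ζ_ℓ) (∫ from μ⁻¹(ζ_ℓ⁺) to 1 of μ([0,t]) dt)²`. -/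
def plateauBound (M : MultiscaleSK) (ℓ : ℕ) (μ : Measure ℝ) : ℝ :=
  2 * (M.γ (ℓ + 1) ^ 2 - M.γ ℓ ^ 2) * quantile μ (M.ζ ℓ) *
    (∫ t in (quantileRight μ (M.ζ ℓ))..1, μ.real (Icc 0 t)) ^ 2

end MultiscaleSK

end

/-! ### Exponentially bounded functions and their averages -/

/-! Fix the weights `ξ` of a stationary pair and move only `x`. On the logarithmic scale a recursion
step with exponent t sends φ to `logStep t c φ`. The new first derivative is the average of φ' under
the Gaussian law tilted by exp(tφ); the new second derivative is the tilted average of φ'' plus t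
times the tilted variance of φ'. Averaging down the chain of tilts gives two numbers per level:
`slope`, the mean s_j of (φ_j')², and `curv`, the mean c_j of φ_j''. They obey the balance c_j + ξ_j
s_j = c_{j+1} + ξ_j s_{j+1} (`RecChain.curvature_add`), and c = 1 - s at the last level, where φ =
log(2 cosh).

By the heat equation the derivative of the averaged φ_0 in the variance of step j is (c_{j+1} + ξ_j
s_{j+1})/2 (`first_variation`). The slopes s_j increase and lie in [0,1], so moving `x` towards s is
an admissible perturbation. After the balance and a summation by parts, minimality along this
direction reads -∑ (ξ_{j+1} - ξ_j) γ̃_{j+1}² (s_{j+1} - x_{j+1})² ≥ 0. Hence s = x wherever `ξ`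
jumps and γ̃ is positive (`IsStationaryPair.slope_eq`).

The gap comes from a Cramér–Rao inequality for the tilted laws (`Regular.le_tilt_variance`), which
gives s_{j+1} - s_j ≥ v_j c_{j+1}², with v_j the variance of step j. Let i+1 and j be the first and
last indices at which `ξ` equals ζ_ℓ. The jump of γ̃ between j and j+1 forces v_j ≥ 2(γ_{ℓ+1}² -
γ_ℓ²) x_{i+1}, while the stationarity equations turn c_{j+1} into ∑ ξ_m (x_{m+1} - x_m), the
integral of the distribution function from x_{j+1} to 1. Since s_j ≥ s_{i+1} = x_{i+1} and s_{j+1} =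
x_{j+1}, this is the asserted inequality for the pair (`IsStationaryPair.gap`).

In the `W1`-limit only one-sided control is needed: asymptotically x_{i+1} is at least a, x_{j+1} is
at most b, and the integral is at least its limit value (`gap_of_tendsto_W1`). The plateau and the
support statements are then facts about quantile functions (`Pr01.real_Icc_eq_of_mem`,
`support_gap`). -/

open ProbabilityTheory in
/-- The standard Gaussian law. -/
noncomputable abbrev stdGauss : Measure ℝ := gaussianReal 0 1

/-- `C e^{C |u|}`, the bound used for functions of at most exponential growth. -/
noncomputable def expGrowth (C u : ℝ) : ℝ := C * Real.exp (C * |u|)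

lemma expGrowth_nonneg {C : ℝ} (hC : 0 ≤ C) (u : ℝ) : 0 ≤ expGrowth C u := by
  unfold expGrowth; positivity

lemma expGrowth_mono_arg {C u v : ℝ} (hC : 0 ≤ C) (h : |u| ≤ |v|) :
    expGrowth C u ≤ expGrowth C v := by
  unfold expGrowth; gcongr

/-- Separating u from η yields dominating functions for the average over η, uniform for bounded u
and bounded coefficients. -/
lemma expGrowth_add_mul_le {C D c : ℝ} (hC : 0 ≤ C) (hc : |c| ≤ D) (u η : ℝ) :
    expGrowth C (u + c * η) ≤ C * Real.exp (C * |u|) * Real.exp (C * D * |η|) := by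
  unfold expGrowth
  rw [mul_assoc, ← Real.exp_add]
  have : |u + c * η| ≤ |u| + D * |η| := by
    calc |u + c * η| ≤ |u| + |c * η| := abs_add_le _ _
      _ ≤ |u| + D * |η| := by rw [abs_mul]; gcongr
  gcongr
  nlinarith [mul_le_mul_of_nonneg_left this hC]

/-- All exponential moments are finite. -/
def HasExpMoments (ν : Measure ℝ) : Prop := ∀ C : ℝ, Integrable (fun η => Real.exp (C * |η|)) ν

lemma hasExpMoments_stdGauss : HasExpMoments stdGauss := fun C =>
  ProbabilityTheory.integrable_exp_mul_abs (X := fun x => x)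
    (ProbabilityTheory.integrable_exp_mul_gaussianReal C)
    (ProbabilityTheory.integrable_exp_mul_gaussianReal (-C))

lemma HasExpMoments.integrable {ν : Measure ℝ} (hν : HasExpMoments ν) {g : ℝ → ℝ}
    (hg : Continuous g) {D C : ℝ} (hb : ∀ η, |g η| ≤ D * Real.exp (C * |η|)) : Integrable g ν :=
  ((hν C).const_mul D).mono' hg.aestronglyMeasurable (ae_of_all _ hb)

/-- Jointly continuous families of functions of at most exponential growth. -/
structure ExpTame {S : Type*} [TopologicalSpace S] (f : S → ℝ → ℝ) : Prop where
  cont : Continuous fun p : S × ℝ => f p.1 p.2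
  bound : ∃ C, 0 ≤ C ∧ ∀ s u, |f s u| ≤ expGrowth C u

namespace ExpTame

variable {S : Type*} [TopologicalSpace S] {f g : S → ℝ → ℝ}

lemma cont_right (hf : ExpTame f) (s : S) : Continuous (f s) :=
  hf.cont.comp (Continuous.prodMk continuous_const continuous_id)

lemma add (hf : ExpTame f) (hg : ExpTame g) : ExpTame fun s u => f s u + g s u := by
  obtain ⟨C, hC, h1⟩ := hf.bound
  obtain ⟨D, hD, h2⟩ := hg.bound
  refine ⟨hf.cont.add hg.cont, C + D, by positivity, fun s u => ?_⟩
  calc |f s u + g s u| ≤ |f s u| + |g s u| := abs_add_le _ _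
    _ ≤ expGrowth C u + expGrowth D u := add_le_add (h1 s u) (h2 s u)
    _ ≤ expGrowth (C + D) u := by
      unfold expGrowth
      rw [add_mul]
      gcongr <;> linarith

lemma mul (hf : ExpTame f) (hg : ExpTame g) : ExpTame fun s u => f s u * g s u := by
  obtain ⟨C, hC, h1⟩ := hf.bound
  obtain ⟨D, hD, h2⟩ := hg.bound
  refine ⟨hf.cont.mul hg.cont, C * D + C + D, by positivity, fun s u => ?_⟩
  rw [abs_mul]
  calc |f s u| * |g s u| ≤ expGrowth C u * expGrowth D u :=
        mul_le_mul (h1 s u) (h2 s u) (abs_nonneg _) (expGrowth_nonneg hC u)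
    _ = C * D * Real.exp ((C + D) * |u|) := by
      unfold expGrowth; rw [add_mul, Real.exp_add]; ring
    _ ≤ expGrowth (C * D + C + D) u := by
      unfold expGrowth
      have : 0 ≤ C * D := by positivity
      gcongr <;> linarith

lemma of_bounded (hf : Continuous fun p : S × ℝ => f p.1 p.2) {C : ℝ} (hb : ∀ s u, |f s u| ≤ C) :
    ExpTame f := by
  refine ⟨hf, |C|, abs_nonneg _, fun s u => (hb s u).trans ((le_abs_self C).trans ?_)⟩
  exact le_mul_of_one_le_right (abs_nonneg _) (Real.one_le_exp (by positivity))

lemma const (c : ℝ) : ExpTame fun (_ : S) (_ : ℝ) => c :=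
  of_bounded continuous_const fun _ _ => le_rfl

lemma const_mul (hf : ExpTame f) (c : ℝ) : ExpTame fun s u => c * f s u := (const c).mul hf

lemma div (hf : ExpTame f) (hg : Continuous fun p : S × ℝ => g p.1 p.2)
    (h1 : ∀ s u, 1 ≤ g s u) : ExpTame fun s u => f s u / g s u := by
  obtain ⟨C, hC, h2⟩ := hf.bound
  refine ⟨hf.cont.div hg fun p => by linarith [h1 p.1 p.2], C, hC, fun s u => ?_⟩
  rw [abs_div, abs_of_nonneg (by linarith [h1 s u] : 0 ≤ g s u)]
  exact (div_le_self (abs_nonneg _) (h1 s u)).trans (h2 s u)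

lemma comp_left {T : Type*} [TopologicalSpace T] (hf : ExpTame f) {e : T → S}
    (he : Continuous e) : ExpTame fun t u => f (e t) u := by
  obtain ⟨C, hC, h⟩ := hf.bound
  exact ⟨hf.cont.comp ((he.comp continuous_fst).prodMk continuous_snd), C, hC, fun t u => h _ u⟩

lemma shift_bound (hf : ExpTame f) {c : S → ℝ} {c₀ : ℝ} (hb : ∀ s, |c s| ≤ c₀) :
    ∃ C D, 0 ≤ C ∧ ∀ s u η,
      |f s (u + c s * η)| ≤ C * Real.exp (C * |u|) * Real.exp (D * |η|) := by
  obtain ⟨C, hC, h⟩ := hf.bound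
  exact ⟨C, C * c₀, hC, fun s u η => (h _ _).trans (expGrowth_add_mul_le hC (hb s) u η)⟩

lemma integrable_shift {ν : Measure ℝ} (hν : HasExpMoments ν) (hf : ExpTame f) (s : S) (u c : ℝ) :
    Integrable (fun η => f s (u + c * η)) ν := by
  obtain ⟨C, hC, h⟩ := hf.bound
  exact hν.integrable ((hf.cont_right s).comp (by fun_prop)) fun η =>
    (h s _).trans (expGrowth_add_mul_le hC le_rfl u η)

lemma integrable {ν : Measure ℝ} (hν : HasExpMoments ν) (hf : ExpTame f) (s : S) :
    Integrable (f s) ν := by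
  simpa using hf.integrable_shift hν s 0 1

lemma integral_shift [FirstCountableTopology S] {ν : Measure ℝ} (hν : HasExpMoments ν)
    (hf : ExpTame f) {c : S → ℝ} (hc : Continuous c) {c₀ : ℝ} (hb : ∀ s, |c s| ≤ c₀) :
    ExpTame fun s u => ∫ η, f s (u + c s * η) ∂ν := by
  obtain ⟨C, D, hC, h⟩ := hf.shift_bound hb
  constructor
  · rw [continuous_iff_continuousAt]
    rintro ⟨s₀, u₀⟩
    have hjc : ∀ η, Continuous fun p : S × ℝ => f p.1 (p.2 + c p.1 * η) := fun η =>
      hf.cont.comp (continuous_fst.prodMk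
        (continuous_snd.add ((hc.comp continuous_fst).mul continuous_const)))
    refine continuousAt_of_dominated
      (bound := fun η => C * Real.exp (C * (|u₀| + 1)) * Real.exp (D * |η|)) ?_ ?_ ?_ ?_
    · exact Eventually.of_forall fun p =>
        ((hf.cont_right p.1).comp (by fun_prop : Continuous fun η => p.2 + c p.1 * η)).aestronglyMeasurable
    · have : ∀ᶠ p : S × ℝ in 𝓝 (s₀, u₀), |p.2| < |u₀| + 1 :=
        (continuous_snd.abs.continuousAt (x := (s₀, u₀))).eventually_lt_const (by simp)
      filter_upwards [this] with p hp
      refine ae_of_all _ fun η => (h _ _ _).trans ?_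
      gcongr
    · exact (hν D).const_mul _
    · exact ae_of_all _ fun η => (hjc η).continuousAt
  · set E := ∫ η, Real.exp (D * |η|) ∂ν
    have hE : 0 ≤ E := integral_nonneg fun η => (Real.exp_pos _).le
    refine ⟨C * E + C, by positivity, fun s u => ?_⟩
    calc |∫ η, f s (u + c s * η) ∂ν| ≤ ∫ η, |f s (u + c s * η)| ∂ν := abs_integral_le_integral_abs
      _ ≤ ∫ η, C * Real.exp (C * |u|) * Real.exp (D * |η|) ∂ν :=
        integral_mono_of_nonneg (ae_of_all _ fun _ => abs_nonneg _) ((hν D).const_mul _)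
          (ae_of_all _ fun η => h s u η)
      _ = C * E * Real.exp (C * |u|) := by rw [integral_const_mul]; ring
      _ ≤ expGrowth (C * E + C) u := by
        unfold expGrowth
        have : 0 ≤ C * E := by positivity
        gcongr <;> linarith

lemma continuous_integral [FirstCountableTopology S] {ν : Measure ℝ} (hν : HasExpMoments ν)
    (hf : ExpTame f) : Continuous fun s => ∫ η, f s η ∂ν := by
  have := (hf.integral_shift hν (c := fun _ => 1) continuous_const (c₀ := 1) (by simp)).cont.comp
    (continuous_id.prodMk (continuous_const (y := (0 : ℝ))))
  simpa [Function.comp_def] using this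

/-- Averaging over an auxiliary parameter in `[0,1]`. -/
lemma intervalIntegral_param {F : S × ℝ → ℝ → ℝ} [FirstCountableTopology S]
    (hF : Continuous fun p : (S × ℝ) × ℝ => F p.1 p.2) {C : ℝ} (hC : 0 ≤ C)
    (hb : ∀ s u, ∀ θ ∈ Icc (0 : ℝ) 1, |F (s, θ) u| ≤ expGrowth C u) :
    ExpTame fun s u => ∫ θ in (0 : ℝ)..1, F (s, θ) u := by
  constructor
  · refine continuous_iff_continuousAt.2 fun p => ?_
    refine intervalIntegral.continuousAt_of_dominated_interval
      (F := fun (q : S × ℝ) θ => F (q.1, θ) q.2) (bound := fun _ => expGrowth C (|p.2| + 1)) ?_ ?_ ?_ ?_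
    · exact Eventually.of_forall fun q => (hF.comp (by fun_prop :
        Continuous fun θ : ℝ => ((q.1, θ), q.2))).aestronglyMeasurable
    · have : ∀ᶠ q : S × ℝ in 𝓝 p, |q.2| < |p.2| + 1 :=
        (continuous_snd.abs.continuousAt (x := p)).eventually_lt_const (by simp)
      filter_upwards [this] with q hq
      refine ae_of_all _ fun θ hθ => (hb _ _ _ ?_).trans (expGrowth_mono_arg hC ?_)
      · rw [uIoc_of_le zero_le_one] at hθ; exact Ioc_subset_Icc_self hθ
      · rw [abs_of_nonneg (by positivity : 0 ≤ |p.2| + 1)]; exact hq.le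
    · simp
    · refine ae_of_all _ fun θ _ => ?_
      exact (hF.comp (by fun_prop : Continuous fun q : S × ℝ => ((q.1, θ), q.2))).continuousAt
  · refine ⟨C, hC, fun s u => ?_⟩
    have := intervalIntegral.norm_integral_le_of_norm_le_const (a := (0 : ℝ)) (b := 1)
      (f := fun θ => F (s, θ) u) (C := expGrowth C u) fun θ hθ => by
        rw [uIoc_of_le zero_le_one] at hθ; exact hb s u θ (Ioc_subset_Icc_self hθ)
    simpa using this

end ExpTame

/-- A single continuous function of at most exponential growth. -/
abbrev ExpTame₁ (f : ℝ → ℝ) : Prop := ExpTame fun (_ : Unit) => f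

lemma ExpTame₁.param {f : ℝ → ℝ} (hf : ExpTame₁ f) {S : Type*} [TopologicalSpace S] :
    ExpTame fun (_ : S) => f :=
  hf.comp_left (e := fun _ => ()) continuous_const

/-! ### Gaussian calculus -/

lemma hasDerivAt_integral_stdGauss {g g' : ℝ → ℝ → ℝ} {u : ℝ} (hg : ∀ v, Continuous (g v))
    (hg' : Continuous (g' u)) {C D E F : ℝ} (hb : ∀ η, |g u η| ≤ E * Real.exp (F * |η|))
    (hb' : ∀ v ∈ Metric.ball u 1, ∀ η, |g' v η| ≤ C * Real.exp (D * |η|))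
    (hd : ∀ v η, HasDerivAt (fun w => g w η) (g' v η) v) :
    HasDerivAt (fun v => ∫ η, g v η ∂stdGauss) (∫ η, g' u η ∂stdGauss) u :=
  (hasDerivAt_integral_of_dominated_loc_of_deriv_le
    (bound := fun η => C * Real.exp (D * |η|)) (Metric.ball_mem_nhds u one_pos)
    (Eventually.of_forall fun v => (hg v).aestronglyMeasurable)
    (hasExpMoments_stdGauss.integrable (hg u) hb) hg'.aestronglyMeasurable
    (ae_of_all _ fun η v hv => hb' v hv η) ((hasExpMoments_stdGauss D).const_mul C)
    (ae_of_all _ fun η v _ => hd v η)).2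

lemma ExpTame₁.abs_le {f : ℝ → ℝ} (hf : ExpTame₁ f) :
    ∃ C, 0 ≤ C ∧ ∀ u, |f u| ≤ expGrowth C u := by
  obtain ⟨C, hC, h⟩ := hf.bound
  exact ⟨C, hC, fun u => h () u⟩

lemma ExpTame₁.continuous {f : ℝ → ℝ} (hf : ExpTame₁ f) : Continuous f := hf.cont_right ()

lemma ExpTame₁.integrable_shift {f : ℝ → ℝ} (hf : ExpTame₁ f) (u c : ℝ) :
    Integrable (fun η => f (u + c * η)) stdGauss :=
  ExpTame.integrable_shift hasExpMoments_stdGauss hf () u c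

lemma ExpTame₁.average {f : ℝ → ℝ} (hf : ExpTame₁ f) (c : ℝ) :
    ExpTame₁ fun u => ∫ η, f (u + c * η) ∂stdGauss :=
  ExpTame.integral_shift hasExpMoments_stdGauss hf (c := fun _ => c) continuous_const (c₀ := |c|)
    fun _ => le_rfl

lemma ExpTame₁.hasDerivAt_average {f f' : ℝ → ℝ} (hf : ExpTame₁ f) (hf' : ExpTame₁ f')
    (hd : ∀ u, HasDerivAt f (f' u) u) (c u : ℝ) :
    HasDerivAt (fun u => ∫ η, f (u + c * η) ∂stdGauss) (∫ η, f' (u + c * η) ∂stdGauss) u := by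
  obtain ⟨C, hC, h⟩ := hf.abs_le
  obtain ⟨C', hC', h'⟩ := hf'.abs_le
  have hfc := hf.continuous
  have hfc' := hf'.continuous
  refine hasDerivAt_integral_stdGauss (g := fun u η => f (u + c * η))
    (g' := fun u η => f' (u + c * η)) (fun v => by fun_prop) (by fun_prop)
    (fun η => (h _).trans (expGrowth_add_mul_le hC le_rfl u η))
    (C := C' * Real.exp (C' * (|u| + 1))) (D := C' * |c|) (fun v hv η => ?_) fun v η => ?_
  · refine (h' _).trans ((expGrowth_add_mul_le hC' le_rfl v η).trans ?_)
    have : |v| ≤ |u| + 1 := by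
      rw [Metric.mem_ball, Real.dist_eq] at hv
      have := abs_sub_abs_le_abs_sub v u
      linarith
    gcongr
  · simpa using (hd (v + c * η)).comp_add_const v (c * η)

lemma abs_mul_le_exp (x : ℝ) {C D y : ℝ} (h : |y| ≤ C * Real.exp (D * |x|)) :
    |x * y| ≤ C * Real.exp ((D + 1) * |x|) := by
  have h0 : |x| ≤ Real.exp |x| := by linarith [Real.add_one_le_exp |x|]
  rw [abs_mul, add_mul, Real.exp_add, one_mul]
  calc |x| * |y| ≤ Real.exp |x| * (C * Real.exp (D * |x|)) := by gcongr
    _ = _ := by ring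

lemma ExpTame₁.integrable_mul_shift {f : ℝ → ℝ} (hf : ExpTame₁ f) (u c : ℝ) :
    Integrable (fun η => η * f (u + c * η)) stdGauss := by
  obtain ⟨C, hC, h⟩ := hf.abs_le
  have hfc := hf.continuous
  exact hasExpMoments_stdGauss.integrable (by fun_prop) fun η => abs_mul_le_exp η
    ((h _).trans (expGrowth_add_mul_le hC le_rfl u η))

open ProbabilityTheory in
/-- Gaussian integration by parts. -/
lemma integral_mul_stdGauss {g g' : ℝ → ℝ} (hd : ∀ u, HasDerivAt g (g' u) u)
    (hg : Integrable g stdGauss) (hg1 : Integrable (fun η => η * g η) stdGauss)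
    (hg' : Integrable g' stdGauss) :
    ∫ η, η * g η ∂stdGauss = ∫ η, g' η ∂stdGauss := by
  have hint : ∀ F : ℝ → ℝ, Integrable F stdGauss →
      Integrable fun η => gaussianPDFReal 0 1 η * F η := by
    intro F hF
    rw [stdGauss, gaussianReal_of_var_ne_zero 0 one_ne_zero,
      integrable_withDensity_iff_integrable_smul' (measurable_gaussianPDF 0 1)
        (ae_of_all _ fun _ => gaussianPDF_lt_top)] at hF
    simpa [toReal_gaussianPDF] using hF
  have hpd : ∀ η, HasDerivAt (gaussianPDFReal 0 1) (-η * gaussianPDFReal 0 1 η) η := by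
    intro η
    rw [gaussianPDFReal_def]
    have : HasDerivAt (fun x : ℝ => -(x - 0) ^ 2 / (2 * ((1 : NNReal) : ℝ))) (-η) η := by
      have := ((hasDerivAt_id η).pow 2).neg.div_const 2
      simp only [NNReal.coe_one, sub_zero, mul_one]
      refine (this.congr_deriv ?_)
      simp; ring
    refine (this.exp.const_mul _).congr_deriv ?_
    ring
  -- The derivative of density times `g` integrates to zero; the density contributes the factor -η.
  have key := integral_eq_zero_of_hasDerivAt_of_integrable
    (f := fun η => gaussianPDFReal 0 1 η * g η)
    (f' := fun η => gaussianPDFReal 0 1 η * g' η - gaussianPDFReal 0 1 η * (η * g η))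
    (fun η => ((hpd η).mul (hd η)).congr_deriv (by ring))
    ((hint _ hg').sub (hint _ hg1)) (hint _ hg)
  rw [integral_sub (hint _ hg') (hint _ hg1)] at key
  rw [integral_gaussianReal_eq_integral_smul one_ne_zero,
    integral_gaussianReal_eq_integral_smul one_ne_zero]
  simp only [smul_eq_mul]
  linarith

lemma ExpTame₁.integral_mul_shift {f f' : ℝ → ℝ} (hf : ExpTame₁ f) (hf' : ExpTame₁ f')
    (hd : ∀ u, HasDerivAt f (f' u) u) (c u : ℝ) :
    ∫ η, η * f (u + c * η) ∂stdGauss = c * ∫ η, f' (u + c * η) ∂stdGauss := by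
  rw [← integral_const_mul]
  refine integral_mul_stdGauss (fun η => ?_) (hf.integrable_shift u c)
    (hf.integrable_mul_shift u c) ((hf'.integrable_shift u c).const_mul c)
  have h1 : HasDerivAt (fun η => u + c * η) c η := by
    simpa using ((hasDerivAt_id η).const_mul c).const_add u
  exact ((hd _).comp η h1).congr_deriv (by ring)

lemma ExpTame₁.hasDerivAt_average_coef {f f' f'' : ℝ → ℝ} (hf : ExpTame₁ f) (hf' : ExpTame₁ f')
    (hf'' : ExpTame₁ f'') (hd : ∀ u, HasDerivAt f (f' u) u) (hd' : ∀ u, HasDerivAt f' (f'' u) u)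
    (u c : ℝ) :
    HasDerivAt (fun c => ∫ η, f (u + c * η) ∂stdGauss)
      (c * ∫ η, f'' (u + c * η) ∂stdGauss) c := by
  rw [← hf'.integral_mul_shift hf'' hd' c u]
  obtain ⟨C, hC, h⟩ := hf.abs_le
  obtain ⟨C', hC', h'⟩ := hf'.abs_le
  have hfc := hf.continuous
  have hfc' := hf'.continuous
  refine hasDerivAt_integral_stdGauss (g := fun c η => f (u + c * η))
    (g' := fun c η => η * f' (u + c * η)) (fun v => by fun_prop) (by fun_prop)
    (fun η => (h _).trans (expGrowth_add_mul_le hC le_rfl u η))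
    (C := C' * Real.exp (C' * |u|)) (D := C' * (|c| + 1) + 1) (fun v hv η => ?_) fun v η => ?_
  · refine abs_mul_le_exp η ((h' _).trans (expGrowth_add_mul_le hC' ?_ u η))
    rw [Metric.mem_ball, Real.dist_eq] at hv
    have := abs_sub_abs_le_abs_sub v c
    linarith
  · have h1 : HasDerivAt (fun c => u + c * η) η v := by
      simpa using ((hasDerivAt_id v).mul_const η).const_add u
    exact ((hd _).comp v h1).congr_deriv (by ring)

/-- The heat equation in integrated form, along a segment of variances. -/
lemma ExpTame₁.average_sub_average {f f' f'' : ℝ → ℝ} (hf : ExpTame₁ f) (hf' : ExpTame₁ f')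
    (hf'' : ExpTame₁ f'') (hd : ∀ u, HasDerivAt f (f' u) u) (hd' : ∀ u, HasDerivAt f' (f'' u) u)
    (u : ℝ) {v w : ℝ} (hv : 0 ≤ v) (hw : 0 ≤ w) :
    ∫ η, f (u + √w * η) ∂stdGauss - ∫ η, f (u + √v * η) ∂stdGauss =
      (w - v) / 2 * ∫ θ in (0 : ℝ)..1, ∫ η, f'' (u + √(v + θ * (w - v)) * η) ∂stdGauss := by
  rcases eq_or_ne v w with rfl | hne
  · simp
  -- The square root is not differentiable at variance 0. An end point may have variance 0, but the
  -- interior of the segment does not, and continuity suffices at the ends.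
  have hpos : ∀ θ ∈ Ioo (0 : ℝ) 1, 0 < v + θ * (w - v) := by
    rintro θ ⟨h0, h1⟩
    rcases hv.lt_or_eq with h | h
    · nlinarith
    · have : 0 < w := lt_of_le_of_ne hw (by rwa [← h] at hne)
      subst h; nlinarith
  have hcont : ∀ {g : ℝ → ℝ}, ExpTame₁ g →
      Continuous fun c => ∫ η, g (u + c * η) ∂stdGauss := by
    intro g hg
    refine continuous_iff_continuousAt.2 fun c₀ => ?_
    obtain ⟨C, hC, h⟩ := hg.abs_le
    have hgc := hg.continuous
    refine continuousAt_of_dominated (bound := fun η =>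
      C * Real.exp (C * |u|) * Real.exp (C * (|c₀| + 1) * |η|)) ?_ ?_ ?_ ?_
    · exact Eventually.of_forall fun c => (by fun_prop :
        Continuous fun η => g (u + c * η)).aestronglyMeasurable
    · have : ∀ᶠ c in 𝓝 c₀, |c| < |c₀| + 1 :=
        (continuous_abs.continuousAt (x := c₀)).eventually_lt_const (by simp)
      filter_upwards [this] with c hc
      exact ae_of_all _ fun η => (h _).trans (expGrowth_add_mul_le hC hc.le u η)
    · exact (hasExpMoments_stdGauss _).const_mul _
    · exact ae_of_all _ fun η => (by fun_prop : Continuous fun c => g (u + c * η)).continuousAt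
  have hsq : Continuous fun θ : ℝ => √(v + θ * (w - v)) := by fun_prop
  have key := intervalIntegral.integral_eq_sub_of_hasDerivAt_of_le (a := 0) (b := 1) zero_le_one
    (f := fun θ => ∫ η, f (u + √(v + θ * (w - v)) * η) ∂stdGauss)
    (f' := fun θ => (w - v) / 2 * ∫ η, f'' (u + √(v + θ * (w - v)) * η) ∂stdGauss)
    ((hcont hf).comp hsq).continuousOn (fun θ hθ => ?_)
    (((hcont hf'').comp hsq).const_smul ((w - v) / 2)).continuousOn.intervalIntegrable
  · rw [intervalIntegral.integral_const_mul] at key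
    simpa using key.symm
  · have h1 : HasDerivAt (fun θ => v + θ * (w - v)) (w - v) θ := by
      simpa using ((hasDerivAt_id θ).mul_const (w - v)).const_add v
    have h2 := h1.sqrt (hpos θ hθ).ne'
    refine ((hf.hasDerivAt_average_coef hf' hf'' hd hd' u _).comp θ h2).congr_deriv ?_
    have := Real.sqrt_pos.2 (hpos θ hθ)
    field_simp

/-! ### One step of the recursion -/

lemma ExpTame.exp_mul {S : Type*} [TopologicalSpace S] {φ : S → ℝ → ℝ}
    (hc : Continuous fun p : S × ℝ => φ p.1 p.2) {C : ℝ} (hC : 0 ≤ C)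
    (hb : ∀ s u, φ s u ≤ C + C * |u|) {t : ℝ} (ht : 0 ≤ t) :
    ExpTame fun s u => Real.exp (t * φ s u) := by
  refine ⟨by fun_prop, Real.exp (t * C) + t * C, by positivity, fun s u => ?_⟩
  rw [abs_of_pos (Real.exp_pos _)]
  unfold expGrowth
  calc Real.exp (t * φ s u) ≤ Real.exp (t * (C + C * |u|)) := by
        gcongr; exact hb s u
    _ = Real.exp (t * C) * Real.exp (t * C * |u|) := by rw [← Real.exp_add]; ring_nf
    _ ≤ _ := by
      have : 0 ≤ t * C := by positivity
      have := Real.exp_pos (t * C)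
      gcongr <;> linarith

/-- The recursion step on the logarithmic scale: `log ∘ gaussStep t c ∘ exp`. -/
noncomputable def logStep (t c : ℝ) (φ : ℝ → ℝ) (u : ℝ) : ℝ :=
  if t = 0 then ∫ η, φ (u + c * η) ∂stdGauss
  else 1 / t * Real.log (∫ η, Real.exp (t * φ (u + c * η)) ∂stdGauss)

/-- The normalizer of the tilted Gaussian average. -/
noncomputable def tiltNorm (t c : ℝ) (φ : ℝ → ℝ) (u : ℝ) : ℝ :=
  ∫ η, Real.exp (t * φ (u + c * η)) ∂stdGauss

/-- The Gaussian average of `f (u + c η)` tilted by the weight `exp (t φ (u + c η))`. -/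
noncomputable def tilt (t c : ℝ) (φ f : ℝ → ℝ) (u : ℝ) : ℝ :=
  (∫ η, Real.exp (t * φ (u + c * η)) * f (u + c * η) ∂stdGauss) / tiltNorm t c φ u

lemma tilt_zero_coef (φ f : ℝ → ℝ) (t : ℝ) : tilt t 0 φ f = f := by
  funext u
  simp [tilt, tiltNorm]

lemma tilt_const_mul (a t c : ℝ) (φ f : ℝ → ℝ) (u : ℝ) :
    tilt t c φ (fun v => a * f v) u = a * tilt t c φ f u := by
  simp only [tilt, mul_left_comm _ a, integral_const_mul]
  ring

lemma logStep_zero_zero (φ : ℝ → ℝ) : logStep 0 0 φ = φ := by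
  funext u
  simp [logStep]

/-- Functions `φ` such that `Z = exp φ` satisfies `Z ≥ 1`, `|Z'| ≤ Z`, `(log Z)'' ≥ 0` and
`Z'' ≤ Z`, together with the first two derivatives of `φ`. -/
structure Regular (φ φ' φ'' : ℝ → ℝ) : Prop where
  hasDerivAt : ∀ u, HasDerivAt φ (φ' u) u
  hasDerivAt' : ∀ u, HasDerivAt φ' (φ'' u) u
  continuous'' : Continuous φ''
  nonneg : ∀ u, 0 ≤ φ u
  abs_le : ∀ u, |φ' u| ≤ 1
  nonneg'' : ∀ u, 0 ≤ φ'' u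
  add_sq_le : ∀ u, φ'' u + φ' u ^ 2 ≤ 1

namespace Regular

variable {φ φ' φ'' : ℝ → ℝ}

lemma continuous (h : Regular φ φ' φ'') : Continuous φ :=
  continuous_iff_continuousAt.2 fun u => (h.hasDerivAt u).continuousAt

lemma continuous' (h : Regular φ φ' φ'') : Continuous φ' :=
  continuous_iff_continuousAt.2 fun u => (h.hasDerivAt' u).continuousAt

lemma le_add_abs (h : Regular φ φ' φ'') (u : ℝ) : φ u ≤ φ 0 + |u| := by
  have := Convex.norm_image_sub_le_of_norm_hasDerivWithin_le (f := φ) (f' := φ') (s := univ)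
    (C := 1) (x := 0) (y := u) (fun x _ => (h.hasDerivAt x).hasDerivWithinAt)
    (fun x _ => h.abs_le x) convex_univ trivial trivial
  rw [sub_zero, one_mul, Real.norm_eq_abs, Real.norm_eq_abs] at this
  linarith [le_abs_self (φ u - φ 0)]

lemma tame_exp (h : Regular φ φ' φ'') {t : ℝ} (ht : 0 ≤ t) :
    ExpTame₁ fun u => Real.exp (t * φ u) := by
  have h0 := h.nonneg 0
  have hc := h.continuous
  refine ExpTame.exp_mul (S := Unit) (φ := fun _ => φ) (C := φ 0 + 1) (by fun_prop)
    (by positivity) (fun _ u => ?_) ht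
  nlinarith [h.le_add_abs u, abs_nonneg u]

lemma tame' (h : Regular φ φ' φ'') : ExpTame₁ φ' := by
  have := h.continuous'
  exact ExpTame.of_bounded (by fun_prop) fun _ => h.abs_le

lemma le_one'' (h : Regular φ φ' φ'') (u : ℝ) : φ'' u ≤ 1 := by
  nlinarith [h.add_sq_le u, sq_nonneg (φ' u)]

lemma tame'' (h : Regular φ φ' φ'') : ExpTame₁ φ'' := by
  have := h.continuous''
  exact ExpTame.of_bounded (by fun_prop) (C := 1) fun _ u => by
    rw [abs_of_nonneg (h.nonneg'' u)]; exact h.le_one'' u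

lemma tame_sq (h : Regular φ φ' φ'') : ExpTame₁ fun u => φ' u ^ 2 := by
  simpa [pow_two] using h.tame'.mul h.tame'

variable {t : ℝ} (c : ℝ)

lemma one_le_tiltNorm (h : Regular φ φ' φ'') (ht : 0 ≤ t) (u : ℝ) : 1 ≤ tiltNorm t c φ u := by
  calc (1 : ℝ) = ∫ _, (1 : ℝ) ∂stdGauss := by simp
    _ ≤ _ := integral_mono (integrable_const _) ((h.tame_exp ht).integrable_shift u c) fun η =>
      Real.one_le_exp (mul_nonneg ht (h.nonneg _))

lemma tame_tilt (h : Regular φ φ' φ'') (ht : 0 ≤ t) {f : ℝ → ℝ} (hf : ExpTame₁ f) :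
    ExpTame₁ (tilt t c φ f) := by
  have h1 := ExpTame₁.average (f := fun u => Real.exp (t * φ u) * f u) ((h.tame_exp ht).mul hf) c
  have h2 := ((h.tame_exp ht).average c).cont
  exact h1.div (g := fun _ u => tiltNorm t c φ u) h2 fun _ u => h.one_le_tiltNorm c ht u

lemma tilt_add (h : Regular φ φ' φ'') (ht : 0 ≤ t) {f g : ℝ → ℝ} (hf : ExpTame₁ f)
    (hg : ExpTame₁ g) (u : ℝ) :
    tilt t c φ (fun v => f v + g v) u = tilt t c φ f u + tilt t c φ g u := by
  have h1 := ExpTame₁.integrable_shift (f := fun u => Real.exp (t * φ u) * f u)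
    ((h.tame_exp ht).mul hf) u c
  have h2 := ExpTame₁.integrable_shift (f := fun u => Real.exp (t * φ u) * g u)
    ((h.tame_exp ht).mul hg) u c
  simp only [tilt, mul_add]
  rw [integral_add h1 h2, add_div]

lemma tilt_const (h : Regular φ φ' φ'') (ht : 0 ≤ t) (a u : ℝ) :
    tilt t c φ (fun _ => a) u = a := by
  have := h.one_le_tiltNorm c ht u
  rw [tilt, integral_mul_const]
  exact mul_div_cancel_left₀ a (by unfold tiltNorm at this; positivity)

lemma tilt_mono (h : Regular φ φ' φ'') (ht : 0 ≤ t) {f g : ℝ → ℝ} (hf : ExpTame₁ f)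
    (hg : ExpTame₁ g) (hfg : ∀ v, f v ≤ g v) (u : ℝ) : tilt t c φ f u ≤ tilt t c φ g u := by
  have h1 := ExpTame₁.integrable_shift (f := fun u => Real.exp (t * φ u) * f u)
    ((h.tame_exp ht).mul hf) u c
  have h2 := ExpTame₁.integrable_shift (f := fun u => Real.exp (t * φ u) * g u)
    ((h.tame_exp ht).mul hg) u c
  have := h.one_le_tiltNorm c ht u
  exact div_le_div_of_nonneg_right (integral_mono h1 h2 fun η =>
    mul_le_mul_of_nonneg_left (hfg _) (Real.exp_pos _).le) (by linarith)

/-- Jensen for the tilted law: average 2mf ≤ f² + m², where m is the tilted mean of f. -/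
lemma tilt_sq_le (h : Regular φ φ' φ'') (ht : 0 ≤ t) {f : ℝ → ℝ} (hf : ExpTame₁ f) (u : ℝ) :
    tilt t c φ f u ^ 2 ≤ tilt t c φ (fun v => f v ^ 2) u := by
  set m := tilt t c φ f u with hm
  have hf2 : ExpTame₁ fun v => f v ^ 2 := by simpa [pow_two] using hf.mul hf
  have h1 : tilt t c φ (fun v => 2 * m * f v) u ≤ tilt t c φ (fun v => f v ^ 2 + m ^ 2) u :=
    h.tilt_mono c ht (hf.const_mul _) (hf2.add (ExpTame.const _))
      (fun v => by nlinarith [sq_nonneg (f v - m)]) u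
  rw [h.tilt_add c ht hf2 (ExpTame.const _), h.tilt_const c ht, tilt_const_mul, ← hm] at h1
  linarith

lemma hasDerivAt_exp (h : Regular φ φ' φ'') (t u : ℝ) :
    HasDerivAt (fun u => Real.exp (t * φ u)) (t * (Real.exp (t * φ u) * φ' u)) u :=
  ((h.hasDerivAt u).const_mul t).exp.congr_deriv (by ring)

lemma hasDerivAt_exp_mul (h : Regular φ φ' φ'') (t u : ℝ) :
    HasDerivAt (fun u => Real.exp (t * φ u) * φ' u)
      (Real.exp (t * φ u) * (φ'' u + t * φ' u ^ 2)) u :=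
  ((h.hasDerivAt_exp t u).mul (h.hasDerivAt' u)).congr_deriv (by ring)

lemma tame_exp_mul (h : Regular φ φ' φ'') (ht : 0 ≤ t) {f : ℝ → ℝ} (hf : ExpTame₁ f) :
    ExpTame₁ fun u => Real.exp (t * φ u) * f u := (h.tame_exp ht).mul hf

lemma tame_second (h : Regular φ φ' φ'') (t : ℝ) : ExpTame₁ fun u => φ'' u + t * φ' u ^ 2 :=
  h.tame''.add (h.tame_sq.const_mul t)

lemma hasDerivAt_tiltNorm (h : Regular φ φ' φ'') (ht : 0 ≤ t) (u : ℝ) :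
    HasDerivAt (tiltNorm t c φ) (t * (tilt t c φ φ' u * tiltNorm t c φ u)) u := by
  have := h.one_le_tiltNorm c ht u
  refine ((h.tame_exp ht).hasDerivAt_average ((h.tame_exp_mul ht h.tame').const_mul t)
    (h.hasDerivAt_exp t) c u).congr_deriv ?_
  rw [integral_const_mul, tilt, div_mul_cancel₀ _ (by positivity)]

lemma tilt_second (h : Regular φ φ' φ'') (ht : 0 ≤ t) (u : ℝ) :
    tilt t c φ (fun v => φ'' v + t * φ' v ^ 2) u =
      tilt t c φ φ'' u + t * tilt t c φ (fun v => φ' v ^ 2) u := by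
  rw [h.tilt_add c ht h.tame'' (h.tame_sq.const_mul t), tilt_const_mul]

/-- The quotient rule: differentiating the weight and its normalizer contributes t times the tilted
variance of `φ'`. -/
lemma hasDerivAt_tilt (h : Regular φ φ' φ'') (ht : 0 ≤ t) (u : ℝ) :
    HasDerivAt (tilt t c φ φ') (tilt t c φ φ'' u +
      t * (tilt t c φ (fun v => φ' v ^ 2) u - tilt t c φ φ' u ^ 2)) u := by
  have h1 := h.one_le_tiltNorm c ht u
  have h0 : tiltNorm t c φ u ≠ 0 := by positivity
  refine (((h.tame_exp_mul ht h.tame').hasDerivAt_average (h.tame_exp_mul ht (h.tame_second t))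
    (h.hasDerivAt_exp_mul t) c u).div (h.hasDerivAt_tiltNorm c ht u) h0).congr_deriv ?_
  have e1 := h.tilt_second c ht u
  rw [tilt, div_eq_iff h0] at e1
  have e2 : tilt t c φ φ' u * tiltNorm t c φ u =
      ∫ η, Real.exp (t * φ (u + c * η)) * φ' (u + c * η) ∂stdGauss := by
    rw [tilt, div_mul_cancel₀ _ h0]
  rw [e1, ← e2]
  field_simp
  ring

/-- The bounds pass to tilted averages, and the variance term is nonnegative. For exponent 0 the
step is the identity, since then `c = 0`. -/
lemma step (h : Regular φ φ' φ'') (ht : 0 ≤ t) (ht1 : t ≤ 1) (hc : t = 0 → c = 0) :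
    Regular (logStep t c φ) (tilt t c φ φ') (fun u => tilt t c φ φ'' u +
      t * (tilt t c φ (fun v => φ' v ^ 2) u - tilt t c φ φ' u ^ 2)) := by
  have hvar := fun u => h.tilt_sq_le c ht h.tame' u
  have hpos : ∀ u, 0 ≤ tilt t c φ φ'' u := fun u => by
    have := h.tilt_mono c ht (ExpTame.const 0) h.tame'' h.nonneg'' u
    rwa [h.tilt_const c ht] at this
  refine ⟨fun u => ?_, h.hasDerivAt_tilt c ht, ?_, fun u => ?_, fun u => ?_, fun u => ?_,
    fun u => ?_⟩
  · rcases eq_or_ne t 0 with rfl | h0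
    · rw [hc rfl, logStep_zero_zero, tilt_zero_coef]; exact h.hasDerivAt u
    · have h1 := h.one_le_tiltNorm c ht u
      have : logStep t c φ = fun u => 1 / t * Real.log (tiltNorm t c φ u) := by
        funext u; simp [logStep, h0, tiltNorm]
      rw [this]
      refine (((h.hasDerivAt_tiltNorm c ht u).log (by positivity)).const_mul _).congr_deriv ?_
      field_simp
  · have h1 := (h.tame_tilt c ht h.tame'').continuous
    have h2 := (h.tame_tilt c ht h.tame_sq).continuous
    have h3 := (h.tame_tilt c ht h.tame').continuous
    fun_prop
  · unfold logStep
    split_ifs with h0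
    · exact integral_nonneg fun η => h.nonneg _
    · exact mul_nonneg (by positivity) (Real.log_nonneg (h.one_le_tiltNorm c ht u))
  · have h1 := h.tilt_mono c ht h.tame' (ExpTame.const 1) (fun v => (_root_.abs_le.1 (h.abs_le v)).2) u
    have h2 := h.tilt_mono c ht (ExpTame.const (-1)) h.tame' (fun v => (_root_.abs_le.1 (h.abs_le v)).1) u
    rw [h.tilt_const c ht] at h1 h2
    exact _root_.abs_le.2 ⟨h2, h1⟩
  · exact add_nonneg (hpos u) (mul_nonneg ht (sub_nonneg.2 (hvar u)))
  -- Here `t ≤ 1` matters: t times the variance is at most the variance, so the sum is at most the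
  -- tilted average of φ'' + φ'².
  · have h1 := h.tilt_mono c ht (h.tame''.add h.tame_sq) (ExpTame.const 1) h.add_sq_le u
    rw [h.tilt_add c ht h.tame'' h.tame_sq, h.tilt_const c ht] at h1
    nlinarith [hvar u]

/-- A Cramér–Rao type lower bound for the tilted variance of `φ'`. -/
lemma le_tilt_variance (h : Regular φ φ' φ'') (ht : 0 ≤ t) (u : ℝ) :
    c ^ 2 * tilt t c φ φ'' u ^ 2 ≤
      tilt t c φ (fun v => φ' v ^ 2) u - tilt t c φ φ' u ^ 2 := by
  have hN := h.one_le_tiltNorm c ht u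
  set N := tiltNorm t c φ u with hNdef
  have hN0 : N ≠ 0 := by positivity
  set b := tilt t c φ φ'' u with hb
  set m := tilt t c φ φ' u with hm
  set q := tilt t c φ (fun v => φ' v ^ 2) u with hq
  have hb0 : 0 ≤ b := by
    have := h.tilt_mono c ht (ExpTame.const 0) h.tame'' h.nonneg'' u
    rwa [h.tilt_const c ht] at this
  have hW := h.tame_exp ht
  have hWf := h.tame_exp_mul ht h.tame'
  have hWff := h.tame_exp_mul ht h.tame_sq
  have hWs := h.tame_exp_mul ht (h.tame_second t)
  have i0 := hW.integrable_shift u c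
  have i1 := hWf.integrable_shift u c
  have i2 := hWff.integrable_shift u c
  have i3 := hW.integrable_mul_shift u c
  have i4 := hWf.integrable_mul_shift u c
  have i5 : Integrable (fun η => η * (η * Real.exp (t * φ (u + c * η)))) stdGauss := by
    obtain ⟨C, hC, hb⟩ := hW.abs_le
    have hcont := h.continuous
    exact hasExpMoments_stdGauss.integrable (by fun_prop) fun η => abs_mul_le_exp η
      (abs_mul_le_exp η ((hb _).trans (expGrowth_add_mul_le hC le_rfl u η)))
  have e0 : ∫ η, Real.exp (t * φ (u + c * η)) ∂stdGauss = N := rfl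
  have e1 : ∫ η, Real.exp (t * φ (u + c * η)) * φ' (u + c * η) ∂stdGauss = m * N := by
    rw [hm, tilt, div_mul_cancel₀ _ hN0]
  have e2 : ∫ η, Real.exp (t * φ (u + c * η)) * φ' (u + c * η) ^ 2 ∂stdGauss = q * N := by
    rw [hq, tilt, div_mul_cancel₀ _ hN0]
  have es : ∫ η, Real.exp (t * φ (u + c * η)) *
      (φ'' (u + c * η) + t * φ' (u + c * η) ^ 2) ∂stdGauss = (b + t * q) * N := by
    rw [hb, hq, ← h.tilt_second c ht, tilt, div_mul_cancel₀ _ hN0]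
  have e3 : ∫ η, η * Real.exp (t * φ (u + c * η)) ∂stdGauss = c * (t * (m * N)) := by
    rw [hW.integral_mul_shift (hWf.const_mul t) (h.hasDerivAt_exp t) c u, integral_const_mul, e1]
  have e4 : ∫ η, η * (Real.exp (t * φ (u + c * η)) * φ' (u + c * η)) ∂stdGauss =
      c * ((b + t * q) * N) := by
    rw [hWf.integral_mul_shift hWs (h.hasDerivAt_exp_mul t) c u, es]
  -- Integration by parts, with η exp(tφ) as the differentiated function.
  have e5 : ∫ η, η * (η * Real.exp (t * φ (u + c * η))) ∂stdGauss =
      N + c * t * (c * ((b + t * q) * N)) := by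
    rw [integral_mul_stdGauss (g' := fun η => Real.exp (t * φ (u + c * η)) +
      c * t * (η * (Real.exp (t * φ (u + c * η)) * φ' (u + c * η)))) (fun η => ?_) i3 i5
      (i0.add (i4.const_mul _)), integral_add i0 (i4.const_mul _), integral_const_mul, e0, e4]
    have h1 : HasDerivAt (fun η => u + c * η) c η := by
      simpa using ((hasDerivAt_id η).const_mul c).const_add u
    refine ((hasDerivAt_id η).mul ((h.hasDerivAt_exp t _).comp η h1)).congr_deriv ?_
    simp only [id, Function.comp_apply]
    ring
  set a := 1 + c * b * (c * t) with ha
  have key : 0 ≤ ∫ η, Real.exp (t * φ (u + c * η)) *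
      (a * φ' (u + c * η) - m - c * b * η) ^ 2 ∂stdGauss :=
    integral_nonneg fun η => mul_nonneg (Real.exp_pos _).le (sq_nonneg _)
  have expand : ∀ η, Real.exp (t * φ (u + c * η)) * (a * φ' (u + c * η) - m - c * b * η) ^ 2 =
      a ^ 2 * (Real.exp (t * φ (u + c * η)) * φ' (u + c * η) ^ 2) +
      (m ^ 2 * Real.exp (t * φ (u + c * η)) +
      ((c * b) ^ 2 * (η * (η * Real.exp (t * φ (u + c * η)))) +
      (-(2 * a * m) * (Real.exp (t * φ (u + c * η)) * φ' (u + c * η)) +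
      (-(2 * a * (c * b)) * (η * (Real.exp (t * φ (u + c * η)) * φ' (u + c * η))) +
      2 * m * (c * b) * (η * Real.exp (t * φ (u + c * η))))))) := fun η => by ring
  have j4 := (i4.const_mul (-(2 * a * (c * b)))).add (i3.const_mul (2 * m * (c * b)))
  have j3 := (i1.const_mul (-(2 * a * m))).add j4
  have j2 := (i5.const_mul ((c * b) ^ 2)).add j3
  have j1 := (i0.const_mul (m ^ 2)).add j2
  simp only [Pi.add_def] at j1 j2 j3 j4
  simp_rw [expand] at key
  rw [integral_add (i2.const_mul _) j1, integral_add (i0.const_mul _) j2,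
    integral_add (i5.const_mul _) j3, integral_add (i1.const_mul _) j4,
    integral_add (i4.const_mul _) (i3.const_mul _)] at key
  simp only [integral_const_mul] at key
  rw [e0, e1, e2, e3, e4, e5] at key
  have key2 : 0 ≤ N * (q - m ^ 2 - c ^ 2 * b ^ 2 - (c * b) ^ 2 * (c ^ 2 * t * b)) := by
    refine key.trans_eq ?_
    rw [ha]; ring
  have key3 := nonneg_of_mul_nonneg_right key2 (by positivity)
  -- The surplus over the Cramér–Rao bound is nonnegative because b, a tilted mean of φ'' ≥ 0, is
  -- nonnegative.
  have : 0 ≤ (c * b) ^ 2 * (c ^ 2 * t * b) := by positivity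
  linarith

end Regular

lemma tanh_sq_add (u : ℝ) : 1 - Real.tanh u ^ 2 = 1 / Real.cosh u ^ 2 := by
  have := Real.cosh_pos u
  rw [Real.tanh_eq_sinh_div_cosh]
  field_simp
  linarith [Real.cosh_sq u]

lemma regular_log_two_cosh :
    Regular (fun u => Real.log (2 * Real.cosh u)) Real.tanh fun u => 1 - Real.tanh u ^ 2 := by
  have hd : ∀ u, HasDerivAt Real.tanh (1 - Real.tanh u ^ 2) u := fun u => by
    have h := (Real.hasDerivAt_sinh u).div (Real.hasDerivAt_cosh u) (Real.cosh_pos u).ne'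
    have e : Real.tanh = fun u => Real.sinh u / Real.cosh u :=
      funext Real.tanh_eq_sinh_div_cosh
    rw [tanh_sq_add, e]
    refine h.congr_deriv ?_
    have := Real.cosh_pos u
    field_simp
    linarith [Real.cosh_sq u]
  have hcont : Continuous Real.tanh :=
    continuous_iff_continuousAt.2 fun u => (hd u).continuousAt
  have hsq : ∀ u, 0 ≤ 1 - Real.tanh u ^ 2 := fun u => by rw [tanh_sq_add]; positivity
  refine ⟨fun u => ?_, hd, by fun_prop, fun u => ?_, fun u => ?_, hsq, fun u => by simp⟩
  · have := Real.cosh_pos u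
    refine (((Real.hasDerivAt_cosh u).const_mul 2).log (by positivity)).congr_deriv ?_
    rw [Real.tanh_eq_sinh_div_cosh]
    field_simp
  · exact Real.log_nonneg (by linarith [Real.one_le_cosh u])
  · exact abs_le_one_iff_mul_self_le_one.2 (by nlinarith [hsq u])

/-! ### Chains of recursion steps -/

lemma Regular.tame {φ φ' φ'' : ℝ → ℝ} (h : Regular φ φ' φ'') : ExpTame₁ φ := by
  obtain ⟨C, hC, hb⟩ := (h.tame_exp (t := 1) zero_le_one).abs_le
  have := h.continuous
  refine ⟨by fun_prop, C, hC, fun _ u => le_trans ?_ (hb u)⟩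
  rw [abs_of_nonneg (h.nonneg u), abs_of_pos (Real.exp_pos _)]
  linarith [Real.add_one_le_exp (1 * φ u)]

/-- A chain of `n` recursion steps with exponents `t j` and coefficients `c j`, leading from
`φ n` down to `φ 0`, with the first two derivatives of the functions involved. -/
structure RecChain (n : ℕ) (t c : ℕ → ℝ) (φ φ' φ'' : ℕ → ℝ → ℝ) : Prop where
  nonneg : ∀ j < n, 0 ≤ t j
  le_one : ∀ j < n, t j ≤ 1
  coef_eq_zero : ∀ j < n, t j = 0 → c j = 0
  regular : ∀ j ≤ n, Regular (φ j) (φ' j) (φ'' j)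
  eq : ∀ j < n, φ j = logStep (t j) (c j) (φ (j + 1))
  eq' : ∀ j < n, φ' j = tilt (t j) (c j) (φ (j + 1)) (φ' (j + 1))
  eq'' : ∀ j < n, ∀ u, φ'' j u = tilt (t j) (c j) (φ (j + 1)) (φ'' (j + 1)) u +
    t j * (tilt (t j) (c j) (φ (j + 1)) (fun v => φ' (j + 1) v ^ 2) u - φ' j u ^ 2)
  last : ∀ u, φ'' n u = 1 - φ' n u ^ 2

/-- The average over the first `j` tilted Gaussian steps, started from the law `ν`. -/
noncomputable def chainAvg (ν : Measure ℝ) (t c : ℕ → ℝ) (φ : ℕ → ℝ → ℝ) : ℕ → (ℝ → ℝ) → ℝ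
  | 0 => fun f => ∫ u, f u ∂ν
  | j + 1 => fun f => chainAvg ν t c φ j (tilt (t j) (c j) (φ (j + 1)) f)

/-- The averaged squared slope `𝔼 W_1 ⋯ W_j (φ_j')²`. -/
noncomputable def slopeSq (ν : Measure ℝ) (t c : ℕ → ℝ) (φ φ' : ℕ → ℝ → ℝ) (j : ℕ) : ℝ :=
  chainAvg ν t c φ j fun u => φ' j u ^ 2

/-- The averaged curvature `𝔼 W_1 ⋯ W_j φ_j''`. -/
noncomputable def curvature (ν : Measure ℝ) (t c : ℕ → ℝ) (φ φ'' : ℕ → ℝ → ℝ) (j : ℕ) : ℝ :=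
  chainAvg ν t c φ j (φ'' j)

lemma chainAvg_const_mul (ν : Measure ℝ) (t c : ℕ → ℝ) (φ : ℕ → ℝ → ℝ) (a : ℝ) (j : ℕ) (f : ℝ → ℝ) :
    chainAvg ν t c φ j (fun u => a * f u) = a * chainAvg ν t c φ j f := by
  induction j generalizing f with
  | zero => exact integral_const_mul _ _
  | succ j ih =>
    simp only [chainAvg]
    rw [← ih]
    congr 1
    funext u
    exact tilt_const_mul _ _ _ _ _ _

namespace RecChain

variable {n : ℕ} {t c : ℕ → ℝ} {φ φ' φ'' : ℕ → ℝ → ℝ} {ν : Measure ℝ}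

lemma tame_tilt (H : RecChain n t c φ φ' φ'') {j : ℕ} (hj : j < n) {f : ℝ → ℝ} (hf : ExpTame₁ f) :
    ExpTame₁ (tilt (t j) (c j) (φ (j + 1)) f) :=
  (H.regular _ hj).tame_tilt _ (H.nonneg j hj) hf

lemma avg_add (H : RecChain n t c φ φ' φ'') (hν : HasExpMoments ν) {j : ℕ} (hj : j ≤ n)
    {f g : ℝ → ℝ} (hf : ExpTame₁ f) (hg : ExpTame₁ g) :
    chainAvg ν t c φ j (fun u => f u + g u) = chainAvg ν t c φ j f + chainAvg ν t c φ j g := by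
  induction j generalizing f g with
  | zero => exact integral_add (ExpTame.integrable hν hf ()) (ExpTame.integrable hν hg ())
  | succ j ih =>
    have hj' : j < n := hj
    simp only [chainAvg]
    rw [← ih hj'.le (H.tame_tilt hj' hf) (H.tame_tilt hj' hg)]
    congr 1
    funext u
    exact (H.regular _ hj).tilt_add _ (H.nonneg j hj') hf hg u

lemma avg_mono (H : RecChain n t c φ φ' φ'') (hν : HasExpMoments ν) {j : ℕ} (hj : j ≤ n)
    {f g : ℝ → ℝ} (hf : ExpTame₁ f) (hg : ExpTame₁ g) (hfg : ∀ u, f u ≤ g u) :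
    chainAvg ν t c φ j f ≤ chainAvg ν t c φ j g := by
  induction j generalizing f g with
  | zero => exact integral_mono (ExpTame.integrable hν hf ()) (ExpTame.integrable hν hg ()) hfg
  | succ j ih =>
    have hj' : j < n := hj
    exact ih hj'.le (H.tame_tilt hj' hf) (H.tame_tilt hj' hg) fun u =>
      (H.regular _ hj).tilt_mono _ (H.nonneg j hj') hf hg hfg u

lemma avg_const [IsProbabilityMeasure ν] (H : RecChain n t c φ φ' φ'') {j : ℕ} (hj : j ≤ n)
    (a : ℝ) : chainAvg ν t c φ j (fun _ => a) = a := by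
  induction j with
  | zero => simp [chainAvg]
  | succ j ih =>
    have hj' : j < n := hj
    simp only [chainAvg]
    refine Eq.trans ?_ (ih hj'.le)
    congr 1
    funext u
    exact (H.regular _ hj).tilt_const _ (H.nonneg j hj') a u

lemma avg_sq_le [IsProbabilityMeasure ν] (H : RecChain n t c φ φ' φ'') (hν : HasExpMoments ν)
    {j : ℕ} (hj : j ≤ n) {f : ℝ → ℝ} (hf : ExpTame₁ f) :
    chainAvg ν t c φ j f ^ 2 ≤ chainAvg ν t c φ j (fun u => f u ^ 2) := by
  set m := chainAvg ν t c φ j f with hm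
  have hf2 : ExpTame₁ fun v => f v ^ 2 := by simpa [pow_two] using hf.mul hf
  have h1 : chainAvg ν t c φ j (fun v => 2 * m * f v) ≤
      chainAvg ν t c φ j (fun v => f v ^ 2 + m ^ 2) :=
    H.avg_mono hν hj (hf.const_mul _) (hf2.add (ExpTame.const _))
      (fun v => by nlinarith [sq_nonneg (f v - m)])
  rw [H.avg_add hν hj hf2 (ExpTame.const _), H.avg_const hj, chainAvg_const_mul, ← hm] at h1
  linarith

lemma avg_second (H : RecChain n t c φ φ' φ'') (hν : HasExpMoments ν) {j : ℕ} (hj : j ≤ n)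
    (a : ℝ) : chainAvg ν t c φ j (fun u => φ'' j u + a * φ' j u ^ 2) =
      curvature ν t c φ φ'' j + a * slopeSq ν t c φ φ' j := by
  rw [H.avg_add hν hj (H.regular j hj).tame'' ((H.regular j hj).tame_sq.const_mul a),
    chainAvg_const_mul]
  rfl

/-- The balance between curvature and slope along one step. -/
lemma curvature_add (H : RecChain n t c φ φ' φ'') (hν : HasExpMoments ν) {j : ℕ} (hj : j < n) :
    curvature ν t c φ φ'' j + t j * slopeSq ν t c φ φ' j =
      curvature ν t c φ φ'' (j + 1) + t j * slopeSq ν t c φ φ' (j + 1) := by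
  rw [← H.avg_second hν hj.le, ← H.avg_second hν (show j + 1 ≤ n from hj)]
  show _ = chainAvg ν t c φ j _
  congr 1
  funext u
  rw [(H.regular _ hj).tilt_second _ (H.nonneg j hj), H.eq'' j hj]
  ring

variable [IsProbabilityMeasure ν]

lemma slopeSq_nonneg (H : RecChain n t c φ φ' φ'') (hν : HasExpMoments ν) {j : ℕ} (hj : j ≤ n) :
    0 ≤ slopeSq ν t c φ φ' j := by
  have := H.avg_mono hν hj (ExpTame.const 0) (H.regular j hj).tame_sq fun u => sq_nonneg (φ' j u)
  rwa [H.avg_const hj] at this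

lemma slopeSq_le_one (H : RecChain n t c φ φ' φ'') (hν : HasExpMoments ν) {j : ℕ} (hj : j ≤ n) :
    slopeSq ν t c φ φ' j ≤ 1 := by
  have := H.avg_mono hν hj (H.regular j hj).tame_sq (ExpTame.const 1) fun u => by
    have h1 := (H.regular j hj).add_sq_le u
    have h2 := (H.regular j hj).nonneg'' u
    linarith
  rwa [H.avg_const hj] at this

/-- The chain starts from log(2 cosh), for which φ'' + φ'² is identically 1. This fixes the constant
when the balance is telescoped. -/
lemma curvature_last (H : RecChain n t c φ φ' φ'') (hν : HasExpMoments ν) :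
    curvature ν t c φ φ'' n = 1 - slopeSq ν t c φ φ' n := by
  have h : (fun u => φ'' n u + 1 * φ' n u ^ 2) = fun _ => 1 := by
    funext u
    rw [H.last]
    ring
  have h2 := H.avg_second hν le_rfl 1
  rw [h, H.avg_const le_rfl] at h2
  linarith

/-- The increment of the averaged squared slope along one step. -/
lemma le_slopeSq_sub (H : RecChain n t c φ φ' φ'') (hν : HasExpMoments ν) {j : ℕ} (hj : j < n) :
    c j ^ 2 * curvature ν t c φ φ'' (j + 1) ^ 2 ≤
      slopeSq ν t c φ φ' (j + 1) - slopeSq ν t c φ φ' j := by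
  have R := H.regular _ (show j + 1 ≤ n from hj)
  have h1 : ExpTame₁ fun u => tilt (t j) (c j) (φ (j + 1)) (φ'' (j + 1)) u ^ 2 := by
    simpa [pow_two] using (H.tame_tilt hj R.tame'').mul (H.tame_tilt hj R.tame'')
  have h2 := H.avg_mono hν hj.le ((h1.const_mul (c j ^ 2)).add (H.regular j hj.le).tame_sq)
    (H.tame_tilt hj R.tame_sq) fun u => by
      have := R.le_tilt_variance (c j) (H.nonneg j hj) u
      rw [← H.eq' j hj] at this
      linarith
  rw [H.avg_add hν hj.le (h1.const_mul _) (H.regular j hj.le).tame_sq, chainAvg_const_mul] at h2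
  have h3 := H.avg_sq_le hν hj.le (H.tame_tilt hj R.tame'')
  have h4 := mul_le_mul_of_nonneg_left h3 (sq_nonneg (c j))
  change c j ^ 2 * curvature ν t c φ φ'' (j + 1) ^ 2 ≤ _ at h4
  change _ + slopeSq ν t c φ φ' j ≤ slopeSq ν t c φ φ' (j + 1) at h2
  linarith

lemma slopeSq_le_succ (H : RecChain n t c φ φ' φ'') (hν : HasExpMoments ν) {j : ℕ} (hj : j < n) :
    slopeSq ν t c φ φ' j ≤ slopeSq ν t c φ φ' (j + 1) := by
  have := H.le_slopeSq_sub hν hj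
  nlinarith [mul_nonneg (sq_nonneg (c j)) (sq_nonneg (curvature ν t c φ φ'' (j + 1)))]

/-- The curvature at level `j`, expressed through the averaged squared slopes. -/
lemma curvature_eq_sum (H : RecChain n t c φ φ' φ'') (hν : HasExpMoments ν) {j : ℕ} (hj : j ≤ n) :
    curvature ν t c φ φ'' j = 1 - slopeSq ν t c φ φ' n +
      ∑ i ∈ Finset.Ico j n, t i * (slopeSq ν t c φ φ' (i + 1) - slopeSq ν t c φ φ' i) := by
  induction hj using Nat.decreasingInduction with
  | self => simp [H.curvature_last hν]
  | of_succ i hi ih =>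
    rw [Finset.sum_eq_sum_Ico_succ_bot hi]
    linarith [H.curvature_add hν hi]

end RecChain

/-! ### The first variation -/

/-- The parameter space of a perturbation. -/
abbrev UnitParam : Type := Icc (0 : ℝ) 1

/-- One step of the first variation: an upper bound `φ^s ≤ φ⁰ + s R` is propagated through a
recursion step whose variance moves along a segment. -/
lemma first_variation_step {φ φ' φ'' : UnitParam → ℝ → ℝ} {R : UnitParam → ℝ → ℝ} {t w d : ℝ}
    (hreg : ∀ s, Regular (φ s) (φ' s) (φ'' s))
    (hcont : Continuous fun p : UnitParam × ℝ => φ p.1 p.2)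
    (ht : 0 < t) (hw : 0 ≤ w) (hwd : 0 ≤ w + d) (hR : ExpTame R)
    (hle : ∀ s u, φ s u ≤ φ 0 u + s * R s u) :
    (Continuous fun p : UnitParam × ℝ => logStep t √(w + p.1 * d) (φ p.1) p.2) ∧
    ∃ R' : UnitParam → ℝ → ℝ, ExpTame R' ∧
      (∀ s : UnitParam, ∀ u, logStep t √(w + s * d) (φ s) u ≤ logStep t √w (φ 0) u + s * R' s u) ∧
      ∀ u, R' 0 u = tilt t √w (φ 0) (R 0) u +
        d / 2 * tilt t √w (φ 0) (fun v => φ'' 0 v + t * φ' 0 v ^ 2) u := by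
  have hpos : ∀ s : UnitParam, 0 ≤ w + s * d := fun s => by nlinarith [s.2.1, s.2.2]
  have hmax : ∀ s : UnitParam, w + s * d ≤ w + |d| := fun s => by
    nlinarith [s.2.1, s.2.2, le_abs_self d, abs_nonneg d]
  set c : UnitParam → ℝ := fun s => √(w + s * d) with hc
  have hcc : Continuous c := by fun_prop
  have hcb : ∀ s, |c s| ≤ √(w + |d|) := fun s => by
    rw [abs_of_nonneg (Real.sqrt_nonneg _)]; exact Real.sqrt_le_sqrt (hmax s)
  have hc0 : c 0 = √w := by simp [hc]
  -- Compactness of the parameter interval; with the unit Lipschitz bound this makes the growth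
  -- uniform in s.
  obtain ⟨C, hC⟩ : ∃ C, ∀ s, φ s 0 ≤ C := by
    have h1 : Continuous fun s => φ s 0 := hcont.comp (continuous_id.prodMk continuous_const)
    obtain ⟨s₀, hs₀⟩ := h1.exists_forall_ge_of_hasCompactSupport
      (HasCompactSupport.of_compactSpace _)
    exact ⟨_, hs₀⟩
  have hexp : ExpTame fun s u => Real.exp (t * φ s u) := by
    refine ExpTame.exp_mul hcont (C := |C| + 1) (by positivity) (fun s u => ?_) ht.le
    nlinarith [(hreg s).le_add_abs u, hC s, le_abs_self C, abs_nonneg u, abs_nonneg C]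
  have hN : ExpTame fun s u => tiltNorm t (c s) (φ s) u :=
    hexp.integral_shift hasExpMoments_stdGauss hcc hcb
  have hN1 : ∀ s (a : ℝ) u, 1 ≤ tiltNorm t a (φ s) u := fun s a u =>
    (hreg s).one_le_tiltNorm a ht.le u
  have hlog : ∀ s (a : ℝ) u, logStep t a (φ s) u = 1 / t * Real.log (tiltNorm t a (φ s) u) :=
    fun s a u => by simp [logStep, ht.ne', tiltNorm]
  refine ⟨?_, ?_⟩
  · simp only [hlog]
    exact (hN.cont.log fun p => (zero_lt_one.trans_le (hN1 _ _ _)).ne').const_smul (1 / t)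
  have h0 := hreg 0
  set G : ℝ → ℝ := fun u => Real.exp (t * φ 0 u) * (φ'' 0 u + t * φ' 0 u ^ 2) with hG
  have hGt : ExpTame₁ G := h0.tame_exp_mul ht.le (h0.tame_second t)
  -- The minimum keeps the coefficient bounded for all real θ, as `integral_shift` demands; it is
  -- inactive for θ in [0,1].
  set e : UnitParam × ℝ → ℝ := fun p => √(min (w + p.2 * (p.1 * d)) (w + |d|)) with he
  have hec : Continuous e := by fun_prop
  have heb : ∀ p, |e p| ≤ √(w + |d|) := fun p => by
    rw [abs_of_nonneg (Real.sqrt_nonneg _)]; exact Real.sqrt_le_sqrt (min_le_right _ _)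
  have hJ := (hGt.param (S := UnitParam × ℝ)).integral_shift hasExpMoments_stdGauss hec heb
  obtain ⟨D, hD, hDb⟩ := hJ.bound
  have hI := ExpTame.intervalIntegral_param
    (F := fun p u => ∫ η, G (u + e p * η) ∂stdGauss) hJ.cont hD fun s u θ _ => hDb (s, θ) u
  have hRe := (hR.mul hexp).integral_shift hasExpMoments_stdGauss hcc hcb
  have hN0 : Continuous fun p : UnitParam × ℝ => tiltNorm t √w (φ 0) p.2 := by
    have := hN.cont.comp (continuous_const.prodMk continuous_snd :
      Continuous fun p : UnitParam × ℝ => ((0 : UnitParam), p.2))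
    simpa [Function.comp_def, hc0] using this
  refine ⟨_, (hRe.add (hI.const_mul (d / 2))).div hN0 fun _ u => hN1 0 _ u, fun s u => ?_,
    fun u => ?_⟩
  · rw [hlog, hlog]
    have hA := hN1 s (c s) u
    have hB := hN1 0 √w u
    set A := tiltNorm t (c s) (φ s) u with hAdef
    set B := tiltNorm t √w (φ 0) u with hBdef
    have i1 := hexp.integrable_shift hasExpMoments_stdGauss s u (c s)
    have i2 := (h0.tame_exp ht.le).integrable_shift u (c s)
    have i3 := (hR.mul hexp).integrable_shift hasExpMoments_stdGauss s u (c s)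
    -- The change A - B is split into changing φ at the moved variance, bounded by convexity of exp,
    -- and moving the variance under φ⁰, computed by the heat equation.
    have d1 : A - ∫ η, Real.exp (t * φ 0 (u + c s * η)) ∂stdGauss ≤
        t * s * ∫ η, R s (u + c s * η) * Real.exp (t * φ s (u + c s * η)) ∂stdGauss := by
      rw [hAdef, tiltNorm, ← integral_sub i1 i2, ← integral_const_mul]
      refine integral_mono (i1.sub i2) (i3.const_mul _) fun η => ?_
      set v := u + c s * η
      simp only
      have k1 := Real.add_one_le_exp (t * φ 0 v - t * φ s v)
      have k2 : Real.exp (t * φ 0 v) =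
          Real.exp (t * φ 0 v - t * φ s v) * Real.exp (t * φ s v) := by
        rw [← Real.exp_add]; ring_nf
      have k3 := mul_le_mul_of_nonneg_right k1 (Real.exp_pos (t * φ s v)).le
      rw [← k2] at k3
      have k4 : (φ s v - φ 0 v) * (t * Real.exp (t * φ s v)) ≤
          (s * R s v) * (t * Real.exp (t * φ s v)) :=
        mul_le_mul_of_nonneg_right (by linarith [hle s v]) (by positivity)
      nlinarith
    have d2 := (h0.tame_exp ht.le).average_sub_average ((h0.tame_exp_mul ht.le h0.tame').const_mul t)
      ((hGt).const_mul t) (h0.hasDerivAt_exp t)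
      (fun v => (h0.hasDerivAt_exp_mul t v).const_mul t) u hw (hpos s)
    rw [show w + s * d - w = s * d by ring] at d2
    simp only [integral_const_mul, intervalIntegral.integral_const_mul] at d2
    have d3 : ∫ θ in (0 : ℝ)..1, ∫ η, G (u + √(w + θ * (s * d)) * η) ∂stdGauss =
        ∫ θ in (0 : ℝ)..1, ∫ η, G (u + e (s, θ) * η) ∂stdGauss := by
      refine intervalIntegral.integral_congr fun θ hθ => ?_
      rw [uIcc_of_le zero_le_one] at hθ
      have : min (w + θ * (s * d)) (w + |d|) = w + θ * (s * d) := by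
        refine min_eq_left ?_
        have h1 : 0 ≤ θ * s := mul_nonneg hθ.1 s.2.1
        have h2 : θ * s ≤ 1 := mul_le_one₀ hθ.2 s.2.1 s.2.2
        nlinarith [le_abs_self d, abs_nonneg d]
      simp only [he, this]
    rw [d3] at d2
    change _ - B = _ at d2
    set I₁ := ∫ η, R s (u + c s * η) * Real.exp (t * φ s (u + c s * η)) ∂stdGauss
    set I₂ := ∫ θ in (0 : ℝ)..1, ∫ η, G (u + e (s, θ) * η) ∂stdGauss
    have d4 : A - B ≤ t * s * (I₁ + d / 2 * I₂) := by
      have : s * d / 2 * (t * I₂) = t * s * (d / 2 * I₂) := by ring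
      linarith
    -- Concavity of log has the right sign: an upper bound along the perturbation is all that
    -- minimality needs.
    have d5 : Real.log A - Real.log B ≤ (A - B) / B := by
      rw [← Real.log_div (by positivity) (by positivity)]
      refine (Real.log_le_sub_one_of_pos (by positivity)).trans_eq ?_
      field_simp
    have d6 : (A - B) / B ≤ t * s * ((I₁ + d / 2 * I₂) / B) := by
      rw [← mul_div_assoc]; gcongr
    have d7 := mul_le_mul_of_nonneg_left (d5.trans d6) (one_div_pos.2 ht).le
    have d8 : 1 / t * (t * s * ((I₁ + d / 2 * I₂) / B)) = s * ((I₁ + d / 2 * I₂) / B) := by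
      field_simp
    linarith
  · have e0 : ∀ θ : ℝ, e (0, θ) = √w := fun θ => by simp [he]
    simp only [e0, hc0, intervalIntegral.integral_const, sub_zero, one_smul, tilt, hG]
    rw [add_div, mul_div_assoc]
    simp only [mul_comm (R 0 _)]

/-- The first variation of the averaged first function of a chain, when the variances of the
steps move along segments. -/
lemma first_variation {n : ℕ} {t w d : ℕ → ℝ} {φ φ' φ'' : UnitParam → ℕ → ℝ → ℝ} {ν : Measure ℝ}
    [IsProbabilityMeasure ν] (hν : HasExpMoments ν)
    (H : ∀ s : UnitParam, RecChain n t (fun j => √(w j + s * d j)) (φ s) (φ' s) (φ'' s))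
    (hw : ∀ j < n, 0 ≤ w j) (hwd : ∀ j < n, 0 ≤ w j + d j)
    (hzero : ∀ j < n, t j = 0 → w j = 0 ∧ d j = 0) (hlast : ∀ s, φ s n = φ 0 n) :
    ∃ r : UnitParam → ℝ, Continuous r ∧
      (∀ s : UnitParam, ∫ u, φ s 0 u ∂ν ≤ ∫ u, φ 0 0 u ∂ν + s * r s) ∧
      r 0 = ∑ j ∈ Finset.range n, d j / 2 *
        (curvature ν t (fun j => √(w j)) (φ 0) (φ'' 0) (j + 1) +
          t j * slopeSq ν t (fun j => √(w j)) (φ 0) (φ' 0) (j + 1)) := by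
  have H0 : RecChain n t (fun j => √(w j)) (φ 0) (φ' 0) (φ'' 0) := by simpa using H 0
  have key : ∀ j ≤ n, (Continuous fun p : UnitParam × ℝ => φ p.1 j p.2) ∧
      ∃ R : UnitParam → ℝ → ℝ, ExpTame R ∧ (∀ s u, φ s j u ≤ φ 0 j u + s * R s u) ∧
        chainAvg ν t (fun j => √(w j)) (φ 0) j (R 0) = ∑ i ∈ Finset.Ico j n, d i / 2 *
          (curvature ν t (fun j => √(w j)) (φ 0) (φ'' 0) (i + 1) +
            t i * slopeSq ν t (fun j => √(w j)) (φ 0) (φ' 0) (i + 1)) := by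
    intro j hj
    induction hj using Nat.decreasingInduction with
    | self =>
      refine ⟨?_, fun _ _ => 0, ExpTame.const 0, fun s u => by simp [hlast], ?_⟩
      · simp only [hlast]
        exact (H0.regular n le_rfl).continuous.comp continuous_snd
      · rw [H0.avg_const le_rfl]; simp
    | of_succ j hj ih =>
      obtain ⟨hc, R, hR, hle, hsum⟩ := ih
      have hj1 : j + 1 ≤ n := hj
      have R1 := H0.regular _ hj1
      rw [Finset.sum_eq_sum_Ico_succ_bot hj, ← hsum, ← H0.avg_second hν hj1]
      have hR0 : ExpTame₁ (R 0) := hR.comp_left (e := fun _ => 0) continuous_const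
      -- At exponent 0 the variance stays zero along the segment, so the step is the identity and
      -- its term in the sum vanishes.
      rcases (H0.nonneg j hj).eq_or_lt with h0 | h0
      · obtain ⟨hw0, hd0⟩ := hzero j hj h0.symm
        have heq : ∀ s, φ s j = φ s (j + 1) := fun s => by
          rw [(H s).eq j hj, ← h0, hw0, hd0]
          simp [logStep_zero_zero]
        refine ⟨by simpa only [heq] using hc, R, hR, by simpa only [heq] using hle, ?_⟩
        rw [hd0]
        simp only [chainAvg, hw0, Real.sqrt_zero, tilt_zero_coef]
        ring
      · obtain ⟨hc', R', hR', hle', hR'0⟩ := first_variation_step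
          (φ := fun s => φ s (j + 1)) (φ' := fun s => φ' s (j + 1)) (φ'' := fun s => φ'' s (j + 1))
          (fun s => (H s).regular _ hj1) hc h0 (hw j hj) (hwd j hj) hR hle
        have heq : ∀ s : UnitParam, φ s j = logStep (t j) √(w j + s * d j) (φ s (j + 1)) :=
          fun s => (H s).eq j hj
        have heq0 : φ 0 j = logStep (t j) √(w j) (φ 0 (j + 1)) := H0.eq j hj
        refine ⟨?_, R', hR', fun s u => ?_, ?_⟩
        · simpa only [heq] using hc'
        · rw [heq s, heq0]; exact hle' s u
        · rw [show R' 0 = _ from funext hR'0,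
            H0.avg_add hν hj.le (H0.tame_tilt hj hR0)
              ((H0.tame_tilt hj (R1.tame_second (t j))).const_mul _), chainAvg_const_mul, add_comm]
          rfl
  obtain ⟨-, R, hR, hle, hsum⟩ := key 0 (Nat.zero_le n)
  refine ⟨fun s => ∫ u, R s u ∂ν, hR.continuous_integral hν, fun s => ?_, ?_⟩
  · have i1 := ExpTame.integrable hν ((H s).regular 0 (Nat.zero_le n)).tame ()
    have i0 := ExpTame.integrable hν (H0.regular 0 (Nat.zero_le n)).tame ()
    have i2 := hR.integrable hν s
    rw [← integral_const_mul, ← integral_add i0 (i2.const_mul _)]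
    exact integral_mono i1 (i0.add (i2.const_mul _)) (hle s)
  · rw [Finset.range_eq_Ico]; exact hsum

/-! ### The chain of a multiscale model -/

/-- The functions of a chain, with their first two derivatives, after `m` of `n` steps. -/
noncomputable def chainFun (n : ℕ) (t c : ℕ → ℝ) : ℕ → (ℝ → ℝ) × (ℝ → ℝ) × (ℝ → ℝ)
  | 0 => (fun u => Real.log (2 * Real.cosh u), Real.tanh, fun u => 1 - Real.tanh u ^ 2)
  | m + 1 =>
    let p := chainFun n t c m
    let s := t (n - 1 - m)
    let a := c (n - 1 - m)
    (logStep s a p.1, tilt s a p.1 p.2.1, fun u => tilt s a p.1 p.2.2 u +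
      s * (tilt s a p.1 (fun v => p.2.1 v ^ 2) u - tilt s a p.1 p.2.1 u ^ 2))

/-- The recursion counts steps from the end while the chain counts levels from the start: level j is
reached after n - j steps, the last of which uses exponent `t j`. -/
lemma recChain_chainFun {n : ℕ} {t c : ℕ → ℝ} (h0 : ∀ j < n, 0 ≤ t j) (h1 : ∀ j < n, t j ≤ 1)
    (hc : ∀ j < n, t j = 0 → c j = 0) :
    RecChain n t c (fun j => (chainFun n t c (n - j)).1) (fun j => (chainFun n t c (n - j)).2.1)
      (fun j => (chainFun n t c (n - j)).2.2) := by
  have hidx : ∀ j < n, n - j = (n - (j + 1)) + 1 ∧ n - 1 - (n - (j + 1)) = j := fun j hj => by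
    omega
  have hreg : ∀ m ≤ n, Regular (chainFun n t c m).1 (chainFun n t c m).2.1
      (chainFun n t c m).2.2 := by
    intro m hm
    induction m with
    | zero => exact regular_log_two_cosh
    | succ m ih =>
      have hj : n - 1 - m < n := by omega
      exact (ih (by omega)).step _ (h0 _ hj) (h1 _ hj) (hc _ hj)
  refine ⟨h0, h1, hc, fun j _ => hreg _ (Nat.sub_le n j), fun j hj => ?_, fun j hj => ?_,
    fun j hj u => ?_, fun u => ?_⟩
  · obtain ⟨e1, e2⟩ := hidx j hj
    simp only [e1, chainFun, e2]
  · obtain ⟨e1, e2⟩ := hidx j hj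
    simp only [e1, chainFun, e2]
  · obtain ⟨e1, e2⟩ := hidx j hj
    simp only [e1, chainFun, e2]
  · simp [chainFun]

lemma gaussStep_exp {φ φ' φ'' : ℝ → ℝ} (h : Regular φ φ' φ'') {t : ℝ} (ht : 0 ≤ t) (c : ℝ) :
    MultiscaleSK.gaussStep t c (fun u => Real.exp (φ u)) = fun u => Real.exp (logStep t c φ u) := by
  funext u
  unfold MultiscaleSK.gaussStep logStep
  split_ifs with h0
  · simp
  · have h1 := h.one_le_tiltNorm c ht u
    unfold tiltNorm at h1
    simp only [← Real.exp_mul, mul_comm _ t]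
    rw [Real.rpow_def_of_pos (by positivity), mul_comm]

lemma hasExpMoments_of_compact {ν : Measure ℝ} [IsProbabilityMeasure ν] {K : Set ℝ}
    (hK : IsCompact K) (hν : ν Kᶜ = 0) : HasExpMoments ν := by
  intro C
  obtain ⟨R, hR⟩ := hK.isBounded.exists_norm_le
  refine Integrable.of_bound (by fun_prop) (Real.exp (|C| * R)) ?_
  have : ∀ᵐ η ∂ν, η ∈ K := by rwa [ae_iff]
  filter_upwards [this] with η hη
  rw [Real.norm_eq_abs, abs_of_pos (Real.exp_pos _)]
  have h1 : |η| ≤ R := hR η hη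
  have : C * |η| ≤ |C| * |η| := mul_le_mul_of_nonneg_right (le_abs_self C) (abs_nonneg η)
  exact Real.exp_le_exp.2 (this.trans (by gcongr))

namespace MultiscaleSK

variable (M : MultiscaleSK)

lemma ζ_lt_of_lt {i j : ℕ} (hij : i < j) (hj : j ≤ M.r) : M.ζ i < M.ζ j := by
  induction j, hij using Nat.le_induction with
  | base => exact M.ζ_lt i hj
  | succ j _ ih => exact (ih (by omega)).trans (M.ζ_lt j hj)

lemma ζ_le_of_le {i j : ℕ} (hij : i ≤ j) (hj : j ≤ M.r) : M.ζ i ≤ M.ζ j := by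
  rcases hij.eq_or_lt with rfl | h
  exacts [le_rfl, (M.ζ_lt_of_lt h hj).le]

lemma ζ_pos {i : ℕ} (hi : i ≤ M.r) : 0 < M.ζ i :=
  M.ζ_zero_pos.trans_le (M.ζ_le_of_le (Nat.zero_le i) hi)

lemma ζ_lt_one {i : ℕ} (hi : i < M.r) : M.ζ i < 1 := M.ζ_last ▸ M.ζ_lt_of_lt hi le_rfl

lemma γ_lt_of_lt {i j : ℕ} (hij : i < j) (hj : j ≤ M.r) : M.γ i < M.γ j := by
  induction j, hij using Nat.le_induction with
  | base => exact M.γ_lt i hj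
  | succ j _ ih => exact (ih (by omega)).trans (M.γ_lt j hj)

lemma γ_le_of_le {i j : ℕ} (hij : i ≤ j) (hj : j ≤ M.r) : M.γ i ≤ M.γ j := by
  rcases hij.eq_or_lt with rfl | h
  exacts [le_rfl, (M.γ_lt_of_lt h hj).le]

lemma γ_nonneg {i : ℕ} (hi : i ≤ M.r) : 0 ≤ M.γ i :=
  M.γ_zero ▸ M.γ_le_of_le (Nat.zero_le i) hi

lemma prevVal_nonneg {i : ℕ} (hi : i ≤ M.r) : 0 ≤ prevVal M.ζ i := by
  cases i with
  | zero => exact le_rfl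
  | succ i => exact (M.ζ_pos (by omega)).le

lemma ζ_le_prevVal {i j : ℕ} (hij : i < j) (hj : j ≤ M.r) : M.ζ i ≤ prevVal M.ζ j := by
  cases j with
  | zero => omega
  | succ j => exact M.ζ_le_of_le (by omega) (by omega)

lemma gammaTilde_eq {i : ℕ} (hi : i ≤ M.r) {t : ℝ} (h1 : prevVal M.ζ i < t) (h2 : t ≤ M.ζ i) :
    M.gammaTilde t = M.γ i := by
  unfold gammaTilde
  rw [Finset.sum_eq_single i, if_pos ⟨h1, h2⟩]
  · intro j hj hji
    rw [Finset.mem_range] at hj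
    refine if_neg fun h => ?_
    rcases lt_or_gt_of_ne hji with hlt | hlt
    · linarith [M.ζ_le_prevVal hlt hi]
    · linarith [M.ζ_le_prevVal hlt (show j ≤ M.r by omega)]
  · intro h
    exact absurd (Finset.mem_range.2 (by omega)) h

lemma gammaTilde_zero : M.gammaTilde 0 = 0 := by
  unfold gammaTilde
  refine Finset.sum_eq_zero fun i hi => if_neg fun h => ?_
  rw [Finset.mem_range] at hi
  linarith [M.prevVal_nonneg (show i ≤ M.r by omega)]

lemma exists_gammaTilde_eq {t : ℝ} (h0 : 0 < t) (h1 : t ≤ 1) :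
    ∃ i ≤ M.r, prevVal M.ζ i < t ∧ t ≤ M.ζ i ∧ M.gammaTilde t = M.γ i := by
  classical
  have hex : ∃ i, t ≤ M.ζ i := ⟨M.r, M.ζ_last ▸ h1⟩
  have hi : Nat.find hex ≤ M.r := Nat.find_min' hex (M.ζ_last ▸ h1)
  have hp : prevVal M.ζ (Nat.find hex) < t := by
    rcases hn : Nat.find hex with _ | i
    · exact h0
    · exact not_le.1 (Nat.find_min hex (by omega : i < Nat.find hex))
  exact ⟨_, hi, hp, Nat.find_spec hex, M.gammaTilde_eq hi hp (Nat.find_spec hex)⟩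

lemma gammaTilde_nonneg {t : ℝ} (h0 : 0 ≤ t) (h1 : t ≤ 1) : 0 ≤ M.gammaTilde t := by
  rcases h0.eq_or_lt with rfl | h0
  · rw [gammaTilde_zero]
  · obtain ⟨i, hi, -, -, h⟩ := M.exists_gammaTilde_eq h0 h1
    exact h ▸ M.γ_nonneg hi

lemma gammaTilde_mono {s t : ℝ} (h0 : 0 ≤ s) (hst : s ≤ t) (h1 : t ≤ 1) :
    M.gammaTilde s ≤ M.gammaTilde t := by
  rcases h0.eq_or_lt with rfl | h0
  · rw [gammaTilde_zero]; exact M.gammaTilde_nonneg hst h1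
  · obtain ⟨i, hi, hi1, -, h⟩ := M.exists_gammaTilde_eq h0 (hst.trans h1)
    obtain ⟨j, hj, -, hj2, h'⟩ := M.exists_gammaTilde_eq (h0.trans_le hst) h1
    rw [h, h']
    refine M.γ_le_of_le (not_lt.1 fun hji => ?_) hj
    linarith [M.ζ_le_prevVal hji hi]

lemma gammaTilde_eq_zero {t : ℝ} (h0 : 0 ≤ t) (h1 : t ≤ M.ζ 0) : M.gammaTilde t = 0 := by
  rcases h0.eq_or_lt with rfl | h0
  · exact M.gammaTilde_zero
  · rw [M.gammaTilde_eq (Nat.zero_le _) h0 h1, M.γ_zero]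

lemma le_gammaTilde {i : ℕ} (hi : i + 1 ≤ M.r) {t : ℝ} (h0 : M.ζ i < t) (h1 : t ≤ 1) :
    M.γ (i + 1) ≤ M.gammaTilde t := by
  obtain ⟨j, hj, -, hj2, h⟩ := M.exists_gammaTilde_eq ((M.ζ_pos (by omega)).trans h0) h1
  rw [h]
  refine M.γ_le_of_le (not_lt.1 fun hji => ?_) hj
  linarith [M.ζ_le_of_le (show j ≤ i by omega) (by omega)]

lemma gammaTilde_ζ {i : ℕ} (hi : i ≤ M.r) : M.gammaTilde (M.ζ i) = M.γ i := by
  refine M.gammaTilde_eq hi ?_ le_rfl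
  cases i with
  | zero => exact M.ζ_zero_pos
  | succ i => exact M.ζ_lt i (by omega)

variable {M}

namespace IsPair

variable {k : ℕ} {x ξ : ℕ → ℝ}

lemma ξ_mono (h : M.IsPair k x ξ) {i j : ℕ} (hij : i ≤ j) (hj : j ≤ k + 1) : ξ i ≤ ξ j := by
  induction j, hij using Nat.le_induction with
  | base => exact le_rfl
  | succ j _ ih => exact (ih (by omega)).trans (h.ξ_le j (by omega))

lemma x_mono (h : M.IsPair k x ξ) {i j : ℕ} (hij : i ≤ j) (hj : j ≤ k + 1) : x i ≤ x j := by
  induction j, hij using Nat.le_induction with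
  | base => exact le_rfl
  | succ j _ ih => exact (ih (by omega)).trans (h.x_le j (by omega))

lemma zero_le_ξ (h : M.IsPair k x ξ) {j : ℕ} (hj : j ≤ k + 1) : 0 ≤ ξ j :=
  h.ξ_nonneg.trans (h.ξ_mono (Nat.zero_le j) hj)

lemma ξ_le_one (h : M.IsPair k x ξ) {j : ℕ} (hj : j ≤ k + 1) : ξ j ≤ 1 :=
  h.ξ_last ▸ h.ξ_mono hj le_rfl

lemma zero_le_x (h : M.IsPair k x ξ) {j : ℕ} (hj : j ≤ k + 1) : 0 ≤ x j :=
  h.x_zero ▸ h.x_mono (Nat.zero_le j) hj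

lemma x_le_one (h : M.IsPair k x ξ) {j : ℕ} (hj : j ≤ k + 1) : x j ≤ 1 :=
  h.x_last ▸ h.x_mono hj le_rfl

lemma gammaTilde_nonneg (h : M.IsPair k x ξ) {j : ℕ} (hj : j ≤ k + 1) :
    0 ≤ M.gammaTilde (ξ j) :=
  M.gammaTilde_nonneg (h.zero_le_ξ hj) (h.ξ_le_one hj)

lemma gammaTilde_le (h : M.IsPair k x ξ) {j : ℕ} (hj : j ≤ k) :
    M.gammaTilde (ξ j) ≤ M.gammaTilde (ξ (j + 1)) :=
  M.gammaTilde_mono (h.zero_le_ξ (by omega)) (h.ξ_le j hj) (h.ξ_le_one (by omega))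

lemma variance_nonneg (h : M.IsPair k x ξ) {j : ℕ} (hj : j ≤ k) :
    0 ≤ M.gammaTilde (ξ (j + 1)) ^ 2 * x (j + 1) - M.gammaTilde (ξ j) ^ 2 * x j := by
  have h1 := h.gammaTilde_nonneg (show j ≤ k + 1 by omega)
  have h2 := h.gammaTilde_le hj
  have h3 := h.x_le j hj
  have h4 := h.zero_le_x (show j ≤ k + 1 by omega)
  have : M.gammaTilde (ξ j) ^ 2 * x j ≤ M.gammaTilde (ξ (j + 1)) ^ 2 * x (j + 1) := by gcongr
  linarith

/-- Since ζ_0 > 0 is one of the weights, ξ_j = 0 forces ξ_{j+1} ≤ ζ_0, where γ̃ equals γ_0 = 0. So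
every step with exponent 0 has zero variance. -/
lemma gammaTilde_eq_zero (h : M.IsPair k x ξ) {j : ℕ} (hj : j ≤ k) (h0 : ξ j = 0) :
    M.gammaTilde (ξ j) = 0 ∧ M.gammaTilde (ξ (j + 1)) = 0 := by
  refine ⟨by rw [h0, M.gammaTilde_zero], ?_⟩
  obtain ⟨i, hi, hζ⟩ := h.ζ_mem 0 (Nat.zero_le _)
  have hji : j + 1 ≤ i := by
    by_contra hlt
    have := h.ξ_mono (show i ≤ j by omega) (by omega)
    linarith [M.ζ_zero_pos]
  exact M.gammaTilde_eq_zero (h.zero_le_ξ (by omega)) (hζ ▸ h.ξ_mono hji hi)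

end IsPair

/-- The variance `2 (γ̃_{j+1}² x_{j+1} - γ̃_j² x_j)` of the step from `j + 1` to `j`. -/
noncomputable def stepVar (M : MultiscaleSK) (x ξ : ℕ → ℝ) (j : ℕ) : ℝ :=
  2 * (M.gammaTilde (ξ (j + 1)) ^ 2 * x (j + 1) - M.gammaTilde (ξ j) ^ 2 * x j)

lemma coef_eq (x ξ : ℕ → ℝ) (j : ℕ) : M.coef x ξ j = √(M.stepVar x ξ j) := by
  rw [coef, stepVar, Real.sqrt_mul (by norm_num)]

lemma Zrec_eq {k : ℕ} {x ξ : ℕ → ℝ} (h : M.IsPair k x ξ) {m : ℕ} (hm : m ≤ k + 1) :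
    M.Zrec k x ξ m =
      fun u => Real.exp ((chainFun (k + 1) ξ (fun j => √(M.stepVar x ξ j)) m).1 u) := by
  have H := recChain_chainFun (n := k + 1) (t := ξ) (c := fun j => √(M.stepVar x ξ j))
    (fun j hj => h.zero_le_ξ hj.le) (fun j hj => h.ξ_le_one hj.le) fun j hj h0 => by
      obtain ⟨h1, h2⟩ := h.gammaTilde_eq_zero (show j ≤ k by omega) h0
      simp [stepVar, h1, h2]
  induction m with
  | zero =>
    funext u
    have := Real.cosh_pos u
    simp only [Zrec, chainFun]
    rw [Real.exp_log (by positivity)]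
  | succ m ih =>
    have hr := H.regular (k + 1 - m) (by omega)
    rw [show k + 1 - (k + 1 - m) = m by omega] at hr
    rw [Zrec, ih (by omega), gaussStep_exp hr (h.zero_le_ξ (by omega)), coef_eq]
    simp [chainFun]

end MultiscaleSK

namespace MultiscaleSK

/-! ### Stationary pairs -/

instance (M : MultiscaleSK) : IsProbabilityMeasure M.fieldLaw := M.fieldLaw_prob

lemma hasExpMoments_fieldLaw (M : MultiscaleSK) : HasExpMoments M.fieldLaw := by
  obtain ⟨K, hK, h⟩ := M.fieldLaw_compact
  exact hasExpMoments_of_compact hK h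

/-- The averaged squared slope `𝔼 W_1 ⋯ W_j (∂_u log Z̃_j)²` of a pair. -/
noncomputable def slope (M : MultiscaleSK) (k : ℕ) (x ξ : ℕ → ℝ) (j : ℕ) : ℝ :=
  let c := fun j => √(M.stepVar x ξ j)
  slopeSq M.fieldLaw ξ c (fun j => (chainFun (k + 1) ξ c (k + 1 - j)).1)
    (fun j => (chainFun (k + 1) ξ c (k + 1 - j)).2.1) j

/-- The averaged curvature `𝔼 W_1 ⋯ W_j ∂_u² log Z̃_j` of a pair. -/
noncomputable def curv (M : MultiscaleSK) (k : ℕ) (x ξ : ℕ → ℝ) (j : ℕ) : ℝ :=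
  let c := fun j => √(M.stepVar x ξ j)
  curvature M.fieldLaw ξ c (fun j => (chainFun (k + 1) ξ c (k + 1 - j)).1)
    (fun j => (chainFun (k + 1) ξ c (k + 1 - j)).2.2) j

variable {M : MultiscaleSK} {k : ℕ} {x y ξ : ℕ → ℝ}

lemma IsPair.stepVar_nonneg (h : M.IsPair k x ξ) {j : ℕ} (hj : j < k + 1) :
    0 ≤ M.stepVar x ξ j := by
  have := h.variance_nonneg (show j ≤ k by omega)
  unfold stepVar; linarith

lemma IsPair.stepVar_eq_zero (h : M.IsPair k x ξ) {j : ℕ} (hj : j < k + 1) (h0 : ξ j = 0) :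
    M.stepVar x ξ j = 0 := by
  obtain ⟨h1, h2⟩ := h.gammaTilde_eq_zero (show j ≤ k by omega) h0
  simp [stepVar, h1, h2]

lemma IsPair.recChain (h : M.IsPair k x ξ) :
    RecChain (k + 1) ξ (fun j => √(M.stepVar x ξ j))
      (fun j => (chainFun (k + 1) ξ (fun j => √(M.stepVar x ξ j)) (k + 1 - j)).1)
      (fun j => (chainFun (k + 1) ξ (fun j => √(M.stepVar x ξ j)) (k + 1 - j)).2.1)
      (fun j => (chainFun (k + 1) ξ (fun j => √(M.stepVar x ξ j)) (k + 1 - j)).2.2) :=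
  recChain_chainFun (fun _ hj => h.zero_le_ξ hj.le) (fun _ hj => h.ξ_le_one hj.le)
    fun j hj h0 => by simp [h.stepVar_eq_zero hj h0]

lemma IsPair.parisi_eq (h : M.IsPair k x ξ) :
    M.parisi k x ξ =
      ∫ u, (chainFun (k + 1) ξ (fun j => √(M.stepVar x ξ j)) (k + 1)).1 u ∂M.fieldLaw
        - 1 / 2 * ∑ j ∈ Finset.range (k + 1),
          ξ j * ((M.gammaTilde (ξ (j + 1)) * x (j + 1)) ^ 2 - (M.gammaTilde (ξ j) * x j) ^ 2) := by
  rw [parisi, Zrec_eq h le_rfl]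
  simp

lemma IsPair.segment (hx : M.IsPair k x ξ) (hy : M.IsPair k y ξ) (s : UnitParam) :
    M.IsPair k (fun j => x j + s * (y j - x j)) ξ where
  ξ_nonneg := hx.ξ_nonneg
  ξ_le := hx.ξ_le
  ξ_k := hx.ξ_k
  ξ_last := hx.ξ_last
  x_zero := by simp [hx.x_zero, hy.x_zero]
  x_le := fun j hj => by
    have h1 := mul_le_mul_of_nonneg_left (hx.x_le j hj) (sub_nonneg.2 s.2.2)
    have h2 := mul_le_mul_of_nonneg_left (hy.x_le j hj) s.2.1
    linarith
  x_last := by simp [hx.x_last, hy.x_last]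
  ζ_mem := hx.ζ_mem

/-- The first variation of the Parisi functional in the direction of another pair with the same
weights. -/
lemma first_variation_nonneg (hx : M.IsPair k x ξ) (hy : M.IsPair k y ξ)
    (hmin : ∀ s : UnitParam, M.parisi k x ξ ≤ M.parisi k (fun j => x j + s * (y j - x j)) ξ) :
    0 ≤ ∑ j ∈ Finset.range (k + 1),
      ((M.gammaTilde (ξ (j + 1)) ^ 2 * (y (j + 1) - x (j + 1)) -
          M.gammaTilde (ξ j) ^ 2 * (y j - x j)) *
          (M.curv k x ξ (j + 1) + ξ j * M.slope k x ξ (j + 1)) -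
        ξ j * (M.gammaTilde (ξ (j + 1)) ^ 2 * x (j + 1) * (y (j + 1) - x (j + 1)) -
          M.gammaTilde (ξ j) ^ 2 * x j * (y j - x j))) := by
  set w : ℕ → ℝ := M.stepVar x ξ with hw
  set d : ℕ → ℝ := fun j => M.stepVar y ξ j - M.stepVar x ξ j with hd
  have hvar : ∀ (s : UnitParam) j,
      M.stepVar (fun j => x j + s * (y j - x j)) ξ j = w j + s * d j := fun s j => by
    simp only [hw, hd, stepVar]; ring
  have hchain : ∀ s : UnitParam, _ := fun s => (hx.segment hy s).recChain
  simp only [hvar] at hchain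
  obtain ⟨r, hr, hle, hr0⟩ := first_variation (w := w) (d := d) M.hasExpMoments_fieldLaw hchain
    (fun j hj => hx.stepVar_nonneg hj) (fun j hj => by simpa [hw, hd] using hy.stepVar_nonneg hj)
    (fun j hj h0 => by simp [hw, hd, hx.stepVar_eq_zero hj h0, hy.stepVar_eq_zero hj h0])
    (fun s => by simp [chainFun])
  set L : ℝ := ∑ j ∈ Finset.range (k + 1), ξ j *
    (M.gammaTilde (ξ (j + 1)) ^ 2 * x (j + 1) * (y (j + 1) - x (j + 1)) -
      M.gammaTilde (ξ j) ^ 2 * x j * (y j - x j)) with hL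
  set N : ℝ := 1 / 2 * ∑ j ∈ Finset.range (k + 1), ξ j *
    ((M.gammaTilde (ξ (j + 1)) * (y (j + 1) - x (j + 1))) ^ 2 -
      (M.gammaTilde (ξ j) * (y j - x j)) ^ 2) with hN
  have hquad : ∀ s : ℝ, 1 / 2 * ∑ j ∈ Finset.range (k + 1), ξ j *
      ((M.gammaTilde (ξ (j + 1)) * (x (j + 1) + s * (y (j + 1) - x (j + 1)))) ^ 2 -
        (M.gammaTilde (ξ j) * (x j + s * (y j - x j))) ^ 2) =
      1 / 2 * ∑ j ∈ Finset.range (k + 1), ξ j *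
        ((M.gammaTilde (ξ (j + 1)) * x (j + 1)) ^ 2 - (M.gammaTilde (ξ j) * x j) ^ 2) +
      s * L + s ^ 2 * N := fun s => by
    simp only [hL, hN, Finset.mul_sum, ← Finset.sum_add_distrib]
    exact Finset.sum_congr rfl fun j _ => by ring
  -- Step variances are affine in `x`, and the correction term is quadratic with linear part L and
  -- quadratic part N. Cancelling s > 0 and letting s tend to 0 leaves r 0 - L ≥ 0.
  have hmain : ∀ s : UnitParam, 0 ≤ s * (r s - L - s * N) := fun s => by
    have h1 := hmin s
    rw [hx.parisi_eq, (hx.segment hy s).parisi_eq, hquad] at h1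
    simp only [hvar] at h1
    have h2 := hle s
    simp only [Nat.sub_zero, Icc.coe_zero, zero_mul, add_zero] at h2
    linarith
  have hlim : Tendsto (fun n : ℕ => (⟨1 / ((n : ℝ) + 1), by positivity,
      by rw [div_le_one (by positivity)]; linarith [n.cast_nonneg (α := ℝ)]⟩ : UnitParam)) atTop
      (𝓝 0) := by
    rw [tendsto_subtype_rng]
    exact tendsto_one_div_add_atTop_nhds_zero_nat
  have hcont : Continuous fun s : UnitParam => r s - L - s * N := by fun_prop
  have h0 : 0 ≤ r 0 - L := by
    have := ge_of_tendsto' ((hcont.tendsto 0).comp hlim) (b := 0) fun n =>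
      nonneg_of_mul_nonneg_right (hmain _) (by show (0 : ℝ) < 1 / ((n : ℝ) + 1); positivity)
    simpa using this
  rw [hr0, hL, ← Finset.sum_sub_distrib] at h0
  refine h0.trans_eq (Finset.sum_congr rfl fun j _ => ?_)
  simp only [Icc.coe_zero, zero_mul, add_zero]
  change d j / 2 * (M.curv k x ξ (j + 1) + ξ j * M.slope k x ξ (j + 1)) - _ = _
  simp only [hd, stepVar]
  ring

/-- Abel summation; it moves the differences onto the weights `ξ`. -/
lemma sum_mul_sub_eq (a h : ℕ → ℝ) (n : ℕ) :
    ∑ j ∈ Finset.range (n + 1), a j * (h (j + 1) - h j) =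
      a n * h (n + 1) - a 0 * h 0 -
        ∑ j ∈ Finset.range n, (a (j + 1) - a j) * h (j + 1) := by
  induction n with
  | zero => simp; ring
  | succ n ih =>
    rw [Finset.sum_range_succ, ih, Finset.sum_range_succ _ n]
    ring

namespace IsPair

lemma slope_nonneg (h : M.IsPair k x ξ) {j : ℕ} (hj : j ≤ k + 1) : 0 ≤ M.slope k x ξ j :=
  h.recChain.slopeSq_nonneg M.hasExpMoments_fieldLaw hj

lemma slope_le_one (h : M.IsPair k x ξ) {j : ℕ} (hj : j ≤ k + 1) : M.slope k x ξ j ≤ 1 :=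
  h.recChain.slopeSq_le_one M.hasExpMoments_fieldLaw hj

lemma slope_le_succ (h : M.IsPair k x ξ) {j : ℕ} (hj : j ≤ k) :
    M.slope k x ξ j ≤ M.slope k x ξ (j + 1) :=
  h.recChain.slopeSq_le_succ M.hasExpMoments_fieldLaw (Nat.lt_succ_of_le hj)

lemma slope_mono (h : M.IsPair k x ξ) {i j : ℕ} (hij : i ≤ j) (hj : j ≤ k + 1) :
    M.slope k x ξ i ≤ M.slope k x ξ j := by
  induction j, hij using Nat.le_induction with
  | base => exact le_rfl
  | succ j _ ih => exact (ih (by omega)).trans (h.slope_le_succ (by omega))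

lemma curv_add (h : M.IsPair k x ξ) {j : ℕ} (hj : j ≤ k) :
    M.curv k x ξ j + ξ j * M.slope k x ξ j =
      M.curv k x ξ (j + 1) + ξ j * M.slope k x ξ (j + 1) :=
  h.recChain.curvature_add M.hasExpMoments_fieldLaw (Nat.lt_succ_of_le hj)

lemma curv_eq_sum (h : M.IsPair k x ξ) {j : ℕ} (hj : j ≤ k + 1) :
    M.curv k x ξ j = 1 - M.slope k x ξ (k + 1) +
      ∑ i ∈ Finset.Ico j (k + 1), ξ i * (M.slope k x ξ (i + 1) - M.slope k x ξ i) :=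
  h.recChain.curvature_eq_sum M.hasExpMoments_fieldLaw hj

lemma le_slope_sub (h : M.IsPair k x ξ) {j : ℕ} (hj : j ≤ k) :
    M.stepVar x ξ j * M.curv k x ξ (j + 1) ^ 2 ≤
      M.slope k x ξ (j + 1) - M.slope k x ξ j := by
  have := h.recChain.le_slopeSq_sub M.hasExpMoments_fieldLaw (Nat.lt_succ_of_le hj)
  rwa [Real.sq_sqrt (h.stepVar_nonneg (Nat.lt_succ_of_le hj))] at this

end IsPair

/-- The stationarity equations: `x_j` equals the averaged squared slope wherever `ξ` jumps. -/
lemma IsStationaryPair.slope_eq (h : M.IsStationaryPair k x ξ) {j : ℕ} (hj : j < k)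
    (hξ : ξ j < ξ (j + 1)) (hγ : 0 < M.gammaTilde (ξ (j + 1))) :
    M.slope k x ξ (j + 1) = x (j + 1) := by
  obtain ⟨hx, hmin⟩ := h
  -- The direction of perturbation is the slope sequence itself, with the end values 0 and 1 that a
  -- pair must have; monotonicity of the slopes makes it admissible.
  set y : ℕ → ℝ := fun j => if j = 0 then 0 else if j ≤ k then M.slope k x ξ j else 1 with hydef
  have hy0 : y 0 = 0 := by simp [hydef]
  have hyl : y (k + 1) = 1 := by simp [hydef]
  have hym : ∀ j < k, y (j + 1) = M.slope k x ξ (j + 1) := fun j hj => by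
    simp [hydef, Nat.succ_le_of_lt hj]
  have hy : M.IsPair k y ξ :=
    { ξ_nonneg := hx.ξ_nonneg, ξ_le := hx.ξ_le, ξ_k := hx.ξ_k, ξ_last := hx.ξ_last
      x_zero := hy0, x_last := hyl, ζ_mem := hx.ζ_mem
      x_le := fun j hj => by
        rcases hj.eq_or_lt with rfl | hj
        · rw [hyl]
          simp only [hydef]
          split_ifs
          · exact zero_le_one
          · exact hx.slope_le_one (by omega)
        · rw [hym j hj]
          cases j with
          | zero => rw [hy0]; exact hx.slope_nonneg (by omega)
          | succ j => rw [hym j (by omega)]; exact hx.slope_le_succ (by omega) }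
  have key := first_variation_nonneg hx hy fun s => hmin _ _ (hx.segment hy s)
  set g : ℕ → ℝ := fun j => M.gammaTilde (ξ j) ^ 2 * (y j - x j) * M.curv k x ξ j with hg
  set p : ℕ → ℝ := fun j =>
    M.gammaTilde (ξ j) ^ 2 * (y j - x j) * (M.slope k x ξ j - x j) with hp
  -- The balance between curvature and slope separates a telescoping part g from a part p that is a
  -- square at interior indices. Both vanish at the two ends.
  have hsum : ∑ j ∈ Finset.range (k + 1),
      ((M.gammaTilde (ξ (j + 1)) ^ 2 * (y (j + 1) - x (j + 1)) -
          M.gammaTilde (ξ j) ^ 2 * (y j - x j)) *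
          (M.curv k x ξ (j + 1) + ξ j * M.slope k x ξ (j + 1)) -
        ξ j * (M.gammaTilde (ξ (j + 1)) ^ 2 * x (j + 1) * (y (j + 1) - x (j + 1)) -
          M.gammaTilde (ξ j) ^ 2 * x j * (y j - x j))) =
      ∑ j ∈ Finset.range (k + 1), ((g (j + 1) - g j) + ξ j * (p (j + 1) - p j)) := by
    refine Finset.sum_congr rfl fun j hj => ?_
    have hbal := hx.curv_add (show j ≤ k by rw [Finset.mem_range] at hj; omega)
    simp only [hg, hp]
    linear_combination (M.gammaTilde (ξ j) ^ 2 * (y j - x j)) * hbal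
  have e0 : y 0 - x 0 = 0 := by rw [hy0, hx.x_zero, sub_zero]
  have el : y (k + 1) - x (k + 1) = 0 := by rw [hyl, hx.x_last, sub_self]
  have hg0 : g 0 = 0 := by simp [hg, e0]
  have hgl : g (k + 1) = 0 := by simp [hg, el]
  have hp0 : p 0 = 0 := by simp [hp, e0]
  have hpl : p (k + 1) = 0 := by simp [hp, el]
  rw [hsum, Finset.sum_add_distrib, Finset.sum_range_sub, sum_mul_sub_eq, hg0, hgl, hp0, hpl] at key
  have hpm : ∀ j < k, p (j + 1) =
      M.gammaTilde (ξ (j + 1)) ^ 2 * (M.slope k x ξ (j + 1) - x (j + 1)) ^ 2 := fun j hj => by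
    simp only [hp, hym j hj]; ring
  have hnn : ∀ j ∈ Finset.range k, 0 ≤ (ξ (j + 1) - ξ j) * p (j + 1) := fun j hj => by
    rw [Finset.mem_range] at hj
    rw [hpm j hj]
    exact mul_nonneg (sub_nonneg.2 (hx.ξ_le j hj.le)) (by positivity)
  have hz : ∑ j ∈ Finset.range k, (ξ (j + 1) - ξ j) * p (j + 1) = 0 :=
    le_antisymm (by linarith) (Finset.sum_nonneg hnn)
  have hzj := (Finset.sum_eq_zero_iff_of_nonneg hnn).1 hz j (Finset.mem_range.2 hj)
  rw [hpm j hj] at hzj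
  have h1 : ξ (j + 1) - ξ j ≠ 0 := (sub_pos.2 hξ).ne'
  have h2 := hγ.ne'
  have h3 : M.slope k x ξ (j + 1) - x (j + 1) = 0 := by
    simpa [h1, h2] using hzj
  linarith

/-- The gap inequality for stationary pairs: if `ξ` jumps to `ζ_ℓ` at the index `i`, and leaves
`ζ_ℓ` at the index `j + 1`, then `x_{j+1} - x_i` is bounded from below. -/
lemma IsStationaryPair.gap (h : M.IsStationaryPair k x ξ) {l i j : ℕ} (hl : 1 ≤ l)
    (hlr : l + 1 ≤ M.r) (hij : i + 1 ≤ j) (hj : j < k) (hi : ξ i < M.ζ l)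
    (hi1 : ξ (i + 1) = M.ζ l) (hjl : ξ j = M.ζ l) (hj1 : M.ζ l < ξ (j + 1)) :
    2 * (M.γ (l + 1) ^ 2 - M.γ l ^ 2) * x (i + 1) *
      (∑ m ∈ Finset.Ico (j + 1) (k + 1), ξ m * (x (m + 1) - x m)) ^ 2 ≤
      x (j + 1) - x (i + 1) := by
  have hx := h.1
  have hγl : 0 < M.γ l := M.γ_zero ▸ M.γ_lt_of_lt (by omega) (by omega)
  have hγlt : M.γ l < M.γ (l + 1) := M.γ_lt l (by omega)
  have hζl : M.ζ 0 < M.ζ l := M.ζ_lt_of_lt (by omega) (by omega)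
  have hγle : M.γ (l + 1) ≤ M.gammaTilde (ξ (j + 1)) :=
    M.le_gammaTilde hlr hj1 (hx.ξ_le_one (by omega))
  have hγj : M.gammaTilde (ξ j) = M.γ l := by rw [hjl, M.gammaTilde_ζ (by omega)]
  have hsi : M.slope k x ξ (i + 1) = x (i + 1) :=
    h.slope_eq (by omega) (by rwa [hi1]) (by rw [hi1, M.gammaTilde_ζ (by omega)]; exact hγl)
  have hsm : ∀ m, j ≤ m → m < k → ξ m < ξ (m + 1) → M.slope k x ξ (m + 1) = x (m + 1) :=
    fun m hm hmk hlt => h.slope_eq hmk hlt (lt_of_lt_of_le (by linarith)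
      (hγle.trans (M.gammaTilde_mono (hx.zero_le_ξ (by omega))
        (hx.ξ_mono (by omega) (by omega)) (hx.ξ_le_one (by omega)))))
  have hsj : M.slope k x ξ (j + 1) = x (j + 1) := hsm j le_rfl hj (by rwa [hjl])
  have hcurv : M.curv k x ξ (j + 1) =
      ∑ m ∈ Finset.Ico (j + 1) (k + 1), ξ m * (x (m + 1) - x m) := by
    rw [hx.curv_eq_sum (by omega)]
    -- Let D_m be slope minus `x`. At each index either `ξ` does not jump, so the weight may be
    -- shifted, or it jumps and D vanishes; hence the sum telescopes to its last term.
    have aux : ∀ n, n ≤ k → j + 1 ≤ n →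
        ∑ m ∈ Finset.Ico (j + 1) n,
            ξ m * ((M.slope k x ξ (m + 1) - x (m + 1)) - (M.slope k x ξ m - x m)) =
          ξ n * (M.slope k x ξ n - x n) := by
      intro n hn hjn
      induction n, hjn using Nat.le_induction with
      | base => simp [hsj]
      | succ n hjn ih =>
        rw [Finset.sum_Ico_succ_top hjn, ih (by omega)]
        rcases (hx.ξ_le n (by omega)).eq_or_lt with he | hlt
        · rw [← he]; ring
        · rw [hsm n (by omega) (by omega) hlt]; ring
    have h1 := aux k le_rfl hj
    rw [Finset.sum_Ico_succ_top hj, Finset.sum_Ico_succ_top hj, hx.ξ_k, hx.x_last]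
    rw [hx.ξ_k] at h1
    have h2 : ∑ m ∈ Finset.Ico (j + 1) k,
        ξ m * ((M.slope k x ξ (m + 1) - x (m + 1)) - (M.slope k x ξ m - x m)) =
        ∑ m ∈ Finset.Ico (j + 1) k, ξ m * (M.slope k x ξ (m + 1) - M.slope k x ξ m) -
        ∑ m ∈ Finset.Ico (j + 1) k, ξ m * (x (m + 1) - x m) := by
      rw [← Finset.sum_sub_distrib]
      exact Finset.sum_congr rfl fun m _ => by ring
    linarith
  -- Cramér–Rao on the one step that leaves ζ_ℓ; across the earlier indices i+1, …, j monotonicity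
  -- of the slopes is enough.
  have hgap := hx.le_slope_sub hj.le
  rw [hcurv, hsj] at hgap
  have hmono := hx.slope_mono hij (by omega)
  rw [hsi] at hmono
  have hxi := hx.zero_le_x (show i + 1 ≤ k + 1 by omega)
  have hxij := hx.x_mono hij (by omega)
  have hvar : 2 * (M.γ (l + 1) ^ 2 - M.γ l ^ 2) * x (i + 1) ≤ M.stepVar x ξ j := by
    unfold stepVar
    rw [hγj]
    have h1 : M.γ (l + 1) ^ 2 * x j ≤ M.gammaTilde (ξ (j + 1)) ^ 2 * x (j + 1) := by
      have := hx.x_le j hj.le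
      have := hxi.trans hxij
      gcongr
      linarith
    have h2 : 0 ≤ M.γ (l + 1) ^ 2 - M.γ l ^ 2 := by nlinarith
    nlinarith [mul_le_mul_of_nonneg_left hxij h2]
  have := mul_le_mul_of_nonneg_right hvar
    (sq_nonneg (∑ m ∈ Finset.Ico (j + 1) (k + 1), ξ m * (x (m + 1) - x m)))
  linarith

end MultiscaleSK

/-! ### Quantile functions -/

section Quantile

variable {μ : Measure ℝ}

lemma Pr01.real_Icc_eq (hμ : μ ∈ Pr01) (t : ℝ) : μ.real (Icc 0 t) = μ.real (Iic t) := by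
  unfold Measure.real
  congr 1
  refine le_antisymm (measure_mono Icc_subset_Iic_self) ?_
  calc μ (Iic t) ≤ μ (Icc 0 t ∪ (Icc 0 1)ᶜ) := measure_mono fun s hs => by
        by_cases h : 0 ≤ s
        · exact Or.inl ⟨h, hs⟩
        · exact Or.inr fun h' => h h'.1
    _ ≤ μ (Icc 0 t) + μ (Icc 0 1)ᶜ := measure_union_le _ _
    _ = μ (Icc 0 t) := by rw [hμ.2, add_zero]

lemma Pr01.mono (hμ : μ ∈ Pr01) : Monotone fun t => μ.real (Icc 0 t) := by
  have := hμ.1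
  exact fun s t hst => measureReal_mono (Icc_subset_Icc_right hst)

lemma Pr01.le_one (hμ : μ ∈ Pr01) (t : ℝ) : μ.real (Icc 0 t) ≤ 1 := by
  have := hμ.1
  exact measureReal_le_one

lemma Pr01.real_Icc_one (hμ : μ ∈ Pr01) : μ.real (Icc 0 1) = 1 := by
  have := hμ.1
  rw [Measure.real, (prob_compl_eq_zero_iff measurableSet_Icc).1 hμ.2, ENNReal.toReal_one]

lemma Pr01.right_continuous (hμ : μ ∈ Pr01) (t : ℝ) :
    Tendsto (fun s => μ.real (Icc 0 s)) (𝓝[>] t) (𝓝 (μ.real (Icc 0 t))) := by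
  have := hμ.1
  have h := (ProbabilityTheory.cdf μ).right_continuous t
  simp only [Pr01.real_Icc_eq hμ, ← ProbabilityTheory.cdf_eq_real]
  exact h.tendsto.mono_left (nhdsWithin_mono _ Ioi_subset_Ici_self)

lemma bddBelow_quantile (μ : Measure ℝ) (p : ℝ) :
    BddBelow {s : ℝ | s ∈ Icc (0 : ℝ) 1 ∧ p ≤ μ.real (Icc 0 s)} := ⟨0, fun _ hs => hs.1.1⟩

lemma quantile_nonneg (μ : Measure ℝ) (p : ℝ) : 0 ≤ quantile μ p :=
  Real.sInf_nonneg fun _ hs => hs.1.1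

lemma Pr01.one_mem (hμ : μ ∈ Pr01) {p : ℝ} (hp : p ≤ 1) :
    (1 : ℝ) ∈ {s : ℝ | s ∈ Icc (0 : ℝ) 1 ∧ p ≤ μ.real (Icc 0 s)} :=
  ⟨⟨zero_le_one, le_rfl⟩, by rwa [Pr01.real_Icc_one hμ]⟩

lemma Pr01.quantile_le_one (hμ : μ ∈ Pr01) {p : ℝ} (hp : p ≤ 1) : quantile μ p ≤ 1 :=
  csInf_le (bddBelow_quantile μ p) (Pr01.one_mem hμ hp)

/-- The Galois connection between quantile and distribution function; right continuity makes the
infimum attained. -/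
lemma Pr01.quantile_le_iff (hμ : μ ∈ Pr01) {p t : ℝ} (hp : p ≤ 1) (ht : t ∈ Icc (0 : ℝ) 1) :
    quantile μ p ≤ t ↔ p ≤ μ.real (Icc 0 t) := by
  refine ⟨fun h => ?_, fun h => csInf_le (bddBelow_quantile μ p) ⟨ht, h⟩⟩
  refine ge_of_tendsto (Pr01.right_continuous hμ t) ?_
  filter_upwards [self_mem_nhdsWithin] with s hs
  obtain ⟨v, hv, hvs⟩ := exists_lt_of_csInf_lt ⟨1, Pr01.one_mem hμ hp⟩ (lt_of_le_of_lt h hs)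
  exact hv.2.trans (Pr01.mono hμ hvs.le)

lemma Pr01.quantile_mono (hμ : μ ∈ Pr01) {p q : ℝ} (hpq : p ≤ q) (hq : q ≤ 1) :
    quantile μ p ≤ quantile μ q :=
  csInf_le_csInf (bddBelow_quantile μ p) ⟨1, Pr01.one_mem hμ hq⟩
    fun _ hs => ⟨hs.1, hpq.trans hs.2⟩

lemma Pr01.intervalIntegrable_quantile (hμ : μ ∈ Pr01) :
    IntervalIntegrable (quantile μ) volume 0 1 :=
  MonotoneOn.intervalIntegrable fun p _ q hq hpq => Pr01.quantile_mono hμ hpq (by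
    rw [uIcc_of_le zero_le_one] at hq; exact hq.2)

lemma Pr01.tendsto_quantileRight (hμ : μ ∈ Pr01) {p : ℝ} (hp : p < 1) :
    Tendsto (quantile μ) (𝓝[>] p) (𝓝 (quantileRight μ p)) := by
  have h := MonotoneOn.tendsto_nhdsWithin_Ioo_right (f := quantile μ) (x := p) (y := 1)
    (nonempty_Ioo.2 hp) (fun a _ b hb hab => Pr01.quantile_mono hμ hab hb.2.le)
    ⟨0, by rintro _ ⟨q, -, rfl⟩; exact quantile_nonneg μ q⟩
  unfold quantileRight
  rwa [rightLim_eq_of_tendsto h]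

lemma Pr01.quantileRight_le (hμ : μ ∈ Pr01) {p q : ℝ} (hpq : p < q) (hq : q ≤ 1) :
    quantileRight μ p ≤ quantile μ q := by
  refine le_of_tendsto (Pr01.tendsto_quantileRight hμ (hpq.trans_le hq)) ?_
  filter_upwards [Ioo_mem_nhdsGT hpq] with s hs
  exact Pr01.quantile_mono hμ hs.2.le hq

lemma Pr01.quantile_le_quantileRight (hμ : μ ∈ Pr01) {p : ℝ} (hp : p < 1) :
    quantile μ p ≤ quantileRight μ p := by
  refine ge_of_tendsto (Pr01.tendsto_quantileRight hμ hp) ?_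
  filter_upwards [Ioo_mem_nhdsGT hp] with s hs
  exact Pr01.quantile_mono hμ hs.1.le hs.2.le

lemma Pr01.exists_quantile_lt (hμ : μ ∈ Pr01) {p t : ℝ} (hp : p < 1)
    (ht : quantileRight μ p < t) : ∃ q, p < q ∧ q ≤ 1 ∧ quantile μ q < t := by
  have h1 := (Pr01.tendsto_quantileRight hμ hp).eventually_lt_const ht
  obtain ⟨q, hq, hq'⟩ := (h1.and (Ioo_mem_nhdsGT hp)).exists
  exact ⟨q, hq'.1, hq'.2.le, hq⟩

lemma Pr01.quantileRight_le_one (hμ : μ ∈ Pr01) {p : ℝ} (hp : p < 1) : quantileRight μ p ≤ 1 :=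
  (Pr01.quantileRight_le hμ hp le_rfl).trans (Pr01.quantile_le_one hμ le_rfl)

/-- The distribution function equals `p` between the two quantiles at `p`. -/
lemma Pr01.real_Icc_eq_of_mem (hμ : μ ∈ Pr01) {p t : ℝ} (hp : p < 1)
    (ht : t ∈ Ico (quantile μ p) (quantileRight μ p)) : μ.real (Icc 0 t) = p := by
  have h01 : t ∈ Icc (0 : ℝ) 1 := ⟨(quantile_nonneg μ p).trans ht.1,
    ht.2.le.trans (Pr01.quantileRight_le_one hμ hp)⟩
  refine le_antisymm (not_lt.1 fun hlt => ?_) ((Pr01.quantile_le_iff hμ hp.le h01).1 ht.1)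
  have h1 := Pr01.quantileRight_le hμ hlt (Pr01.le_one hμ t)
  have h2 := (Pr01.quantile_le_iff hμ (Pr01.le_one hμ t) h01).2 le_rfl
  linarith [ht.2]

/-- The integrated distribution function in terms of the quantile function. -/
lemma Pr01.integral_real_Icc (hμ : μ ∈ Pr01) {b : ℝ} (hb : b ∈ Icc (0 : ℝ) 1) :
    ∫ t in b..1, μ.real (Icc 0 t) = ∫ p in (0 : ℝ)..1, (1 - max b (quantile μ p)) := by
  rw [intervalIntegral.integral_of_le hb.2, intervalIntegral.integral_of_le zero_le_one]
  -- The region under the distribution function: its slice at t has length F(t), its slice at height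
  -- p is [max(b, quantile), 1], and Fubini equates the two areas.
  set A : Set (ℝ × ℝ) := {z | z.2 ≤ μ.real (Icc 0 z.1)} with hA
  have hAm : MeasurableSet A :=
    measurableSet_le measurable_snd ((Pr01.mono hμ).measurable.comp measurable_fst)
  have hint : Integrable (Function.uncurry fun t p => A.indicator (fun _ => (1 : ℝ)) (t, p))
      ((volume.restrict (Ioc b 1)).prod (volume.restrict (Ioc 0 1))) :=
    (integrable_const (1 : ℝ)).indicator hAm
  have h1 : ∀ t, ∫ p in Ioc (0 : ℝ) 1, A.indicator (fun _ => (1 : ℝ)) (t, p) =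
      μ.real (Icc 0 t) := by
    intro t
    have : (fun p => A.indicator (fun _ => (1 : ℝ)) (t, p)) =
        (Iic (μ.real (Icc 0 t))).indicator 1 := by
      funext p; simp [indicator, hA]
    rw [this, integral_indicator_one measurableSet_Iic, measureReal_restrict_apply measurableSet_Iic,
      inter_comm, Ioc_inter_Iic, min_eq_right (Pr01.le_one hμ t), Real.volume_real_Ioc_of_le
        measureReal_nonneg, sub_zero]
  have h2 : ∀ p ∈ Ioc (0 : ℝ) 1, ∫ t in Ioc b 1, A.indicator (fun _ => (1 : ℝ)) (t, p) =
      1 - max b (quantile μ p) := by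
    intro p hp
    have hq : quantile μ p ≤ 1 := Pr01.quantile_le_one hμ hp.2
    rw [← integral_Icc_eq_integral_Ioc]
    have : ∫ t in Icc b 1, A.indicator (fun _ => (1 : ℝ)) (t, p) =
        ∫ t in Icc b 1, (Ici (quantile μ p)).indicator 1 t := by
      refine setIntegral_congr_fun measurableSet_Icc fun t ht => ?_
      have := Pr01.quantile_le_iff hμ hp.2 (t := t) ⟨hb.1.trans ht.1, ht.2⟩
      simp only [indicator, hA, mem_ofPred_eq, mem_Ici, ← this, Pi.one_apply]
    rw [this, integral_indicator_one measurableSet_Ici,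
      measureReal_restrict_apply measurableSet_Ici, inter_comm]
    have hset : Icc b 1 ∩ Ici (quantile μ p) = Icc (max b (quantile μ p)) 1 := by
      ext s; simp only [mem_inter_iff, mem_Icc, mem_Ici, max_le_iff]; tauto
    rw [hset, Real.volume_real_Icc_of_le (max_le hb.2 hq)]
  simp_rw [← h1]
  rw [integral_integral_swap hint]
  exact setIntegral_congr_fun measurableSet_Ioc h2

lemma le_W1 {ν : Measure ℝ} (hμ : μ ∈ Pr01) (hν : ν ∈ Pr01) {p q δ : ℝ} (hp : 0 ≤ p) (hpq : p ≤ q)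
    (hq : q ≤ 1) (h : ∀ s ∈ Ioc p q, δ ≤ |quantile ν s - quantile μ s|) :
    (q - p) * δ ≤ W1 ν μ := by
  have hi := ((Pr01.intervalIntegrable_quantile hν).sub
    (Pr01.intervalIntegrable_quantile hμ)).abs
  calc (q - p) * δ = ∫ _ in p..q, δ := by simp
    _ ≤ ∫ s in p..q, |quantile ν s - quantile μ s| := by
      refine intervalIntegral.integral_mono_on_of_le_Ioo hpq (by simp) (hi.mono_set ?_)
        fun s hs => h s ⟨hs.1, hs.2.le⟩
      rw [uIcc_of_le hpq, uIcc_of_le zero_le_one]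
      exact Icc_subset_Icc hp hq
    _ ≤ W1 ν μ := intervalIntegral.integral_mono_interval hp hpq hq
      (ae_of_all _ fun _ => abs_nonneg _) hi

/-- The gap inequality passes to `W₁`-limits. -/
lemma gap_of_tendsto_W1 (hμ : μ ∈ Pr01) {ζ κ : ℝ} (h0 : 0 < ζ) (h1 : ζ < 1) (hκ : 0 ≤ κ)
    {ν : ℕ → Measure ℝ} (hν : ∀ n, ν n ∈ Pr01) {α β : ℕ → ℝ} (hα : ∀ n, 0 ≤ α n)
    (hβ : ∀ n, β n ∈ Icc (0 : ℝ) 1) (hqα : ∀ n, ∀ p ∈ Ioc 0 ζ, quantile (ν n) p ≤ α n)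
    (hqβ : ∀ n, ∀ p ∈ Ioc ζ 1, β n ≤ quantile (ν n) p)
    (hgap : ∀ n, κ * α n * (∫ t in (β n)..1, (ν n).real (Icc 0 t)) ^ 2 ≤ β n - α n)
    (hlim : Tendsto (fun n => W1 (ν n) μ) atTop (𝓝 0)) :
    κ * quantile μ ζ * (∫ t in (quantileRight μ ζ)..1, μ.real (Icc 0 t)) ^ 2 ≤
      quantileRight μ ζ - quantile μ ζ := by
  set a := quantile μ ζ with ha
  set b := quantileRight μ ζ with hb
  set I := ∫ t in b..1, μ.real (Icc 0 t) with hI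
  have ha0 : 0 ≤ a := quantile_nonneg μ ζ
  have ha1 : a ≤ 1 := Pr01.quantile_le_one hμ h1.le
  have hab : a ≤ b := Pr01.quantile_le_quantileRight hμ h1
  have hb1 : b ∈ Icc (0 : ℝ) 1 := ⟨ha0.trans hab, Pr01.quantileRight_le_one hμ h1⟩
  have hI0 : 0 ≤ I := intervalIntegral.integral_nonneg hb1.2 fun _ _ => measureReal_nonneg
  -- If α_n < a - ε, the quantile functions differ by at least ε/2 for all p between F(a - ε/2) and
  -- ζ, an interval of positive length independent of n, which keeps `W1` away from 0.
  have hleft : ∀ ε > 0, ∀ᶠ n in atTop, a - ε ≤ α n := by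
    intro ε hε
    rcases le_or_gt a ε with hle | hlt
    · exact Eventually.of_forall fun n => by linarith [hα n]
    have hmem : a - ε / 2 ∈ Icc (0 : ℝ) 1 := ⟨by linarith, by linarith⟩
    have hp : μ.real (Icc 0 (a - ε / 2)) < ζ := not_le.1 fun h => by
      have := (Pr01.quantile_le_iff hμ h1.le hmem).2 h
      linarith
    have hc : 0 < (ζ - μ.real (Icc 0 (a - ε / 2))) * (ε / 2) :=
      mul_pos (by linarith) (by linarith)
    filter_upwards [hlim.eventually_lt_const hc] with n hn
    by_contra! hαn
    refine absurd (le_W1 hμ (hν n) measureReal_nonneg hp.le h1.le (δ := ε / 2) fun s hs => ?_)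
      (not_le.2 hn)
    have h2 := hqα n s ⟨measureReal_nonneg.trans_lt hs.1, hs.2⟩
    have h3 : a - ε / 2 < quantile μ s := not_le.1 fun h => by
      have := (Pr01.quantile_le_iff hμ (hs.2.trans h1.le) hmem).1 h
      linarith [hs.1]
    rw [abs_sub_comm]
    exact le_trans (by linarith) (le_abs_self _)
  -- The same argument to the right of ζ: some q > ζ has quantile below b + ε/2, so β_n > b + ε
  -- would cost at least (q - ζ) ε/2 in `W1`.
  have hright : ∀ ε > 0, ∀ᶠ n in atTop, β n ≤ b + ε := by
    intro ε hε
    obtain ⟨q, hq0, hq1, hq⟩ := Pr01.exists_quantile_lt hμ h1 (show b < b + ε / 2 by linarith)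
    have hc : 0 < (q - ζ) * (ε / 2) := mul_pos (by linarith) (by linarith)
    filter_upwards [hlim.eventually_lt_const hc] with n hn
    by_contra! hβn
    refine absurd (le_W1 hμ (hν n) h0.le hq0.le hq1 (δ := ε / 2) fun s hs => ?_) (not_le.2 hn)
    have h2 := hqβ n s ⟨hs.1, hs.2.trans hq1⟩
    have h3 := Pr01.quantile_mono hμ hs.2 hq1
    exact le_trans (by linarith) (le_abs_self _)
  -- Truncating at 0 keeps the product monotone in its factors when a - ε or I - 2ε is negative; at
  -- ε = 0 the truncation has no effect.
  have hcont : Continuous fun ε : ℝ =>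
      b - a + 2 * ε - κ * max (a - ε) 0 * max (I - 2 * ε) 0 ^ 2 := by fun_prop
  have hpos : ∀ ε > 0, 0 ≤ b - a + 2 * ε - κ * max (a - ε) 0 * max (I - 2 * ε) 0 ^ 2 := by
    intro ε hε
    obtain ⟨n, ⟨hn1, hn2⟩, hn3⟩ :=
      (((hleft ε hε).and (hright ε hε)).and (hlim.eventually_lt_const hε)).exists
    -- Written through quantiles, the integral loses at most one ε from β_n ≤ b + ε and one from
    -- `W1`.
    have hIn : I - 2 * ε ≤ ∫ t in (β n)..1, (ν n).real (Icc 0 t) := by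
      rw [Pr01.integral_real_Icc (hν n) (hβ n), hI, Pr01.integral_real_Icc hμ hb1]
      have i1 := Pr01.intervalIntegrable_quantile (hν n)
      have i2 := Pr01.intervalIntegrable_quantile hμ
      have hmaxi : ∀ {ν : Measure ℝ}, ν ∈ Pr01 → ∀ c : ℝ,
          IntervalIntegrable (fun p => 1 - max c (quantile ν p)) volume 0 1 := by
        intro ν hν c
        refine intervalIntegrable_const.sub (MonotoneOn.intervalIntegrable ?_)
        intro p _ q hq hpq
        rw [uIcc_of_le zero_le_one] at hq
        exact max_le_max le_rfl (Pr01.quantile_mono hν hpq hq.2)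
      have i3 := (i1.sub i2).abs
      have hle := intervalIntegral.integral_mono_on (a := 0) (b := 1) zero_le_one
        (((hmaxi hμ b).sub intervalIntegrable_const).sub i3) (hmaxi (hν n) (β n))
        (f := fun p => 1 - max b (quantile μ p) - ε - |quantile (ν n) p - quantile μ p|)
        fun p _ => by
          have e1 := le_max_left b (quantile μ p)
          have e2 := le_max_right b (quantile μ p)
          have e3 := le_abs_self (quantile (ν n) p - quantile μ p)
          have e4 := abs_nonneg (quantile (ν n) p - quantile μ p)
          have : max (β n) (quantile (ν n) p) ≤
              max b (quantile μ p) + ε + |quantile (ν n) p - quantile μ p| :=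
            max_le (by linarith) (by linarith)
          linarith
      rw [intervalIntegral.integral_sub ((hmaxi hμ b).sub intervalIntegrable_const) i3,
        intervalIntegral.integral_sub (hmaxi hμ b) intervalIntegrable_const] at hle
      have hW : ∫ p in (0 : ℝ)..1, |quantile (ν n) p - quantile μ p| < ε := hn3
      simp only [intervalIntegral.integral_const, sub_zero, one_smul] at hle
      linarith
    have hInn : 0 ≤ ∫ t in (β n)..1, (ν n).real (Icc 0 t) :=
      intervalIntegral.integral_nonneg (hβ n).2 fun _ _ => measureReal_nonneg
    have h2 : max (a - ε) 0 ≤ α n := max_le hn1 (hα n)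
    have h3 : max (I - 2 * ε) 0 ≤ ∫ t in (β n)..1, (ν n).real (Icc 0 t) := max_le hIn hInn
    have h4 : κ * max (a - ε) 0 * max (I - 2 * ε) 0 ^ 2 ≤
        κ * α n * (∫ t in (β n)..1, (ν n).real (Icc 0 t)) ^ 2 := by
      have := hα n
      gcongr
    linarith [hgap n]
  have hfin : 0 ≤ b - a + 2 * 0 - κ * max (a - 0) 0 * max (I - 2 * 0) 0 ^ 2 :=
    ge_of_tendsto (b := (0 : ℝ)) ((hcont.tendsto 0).mono_left (nhdsWithin_le_nhds (s := Ioi 0)))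
      (by filter_upwards [self_mem_nhdsWithin] with ε hε using hpos ε hε)
  rw [mul_zero, add_zero, sub_zero, sub_zero, max_eq_left ha0, max_eq_left hI0] at hfin
  linarith

end Quantile

namespace MultiscaleSK

/-! ### The measure associated with a pair -/

namespace IsPair

variable {M : MultiscaleSK} {k : ℕ} {x ξ : ℕ → ℝ}

lemma prevVal_le (h : M.IsPair k x ξ) {j : ℕ} (hj : j ≤ k) : prevVal ξ j ≤ ξ j := by
  cases j with
  | zero => exact h.ξ_nonneg
  | succ j => exact h.ξ_le j (by omega)

lemma sum_weights (ξ : ℕ → ℝ) (n : ℕ) :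
    ∑ j ∈ Finset.range n, (ξ j - prevVal ξ j) = prevVal ξ n := by
  induction n with
  | zero => simp [prevVal]
  | succ n ih => rw [Finset.sum_range_succ, ih]; simp [prevVal]

lemma stepLaw_apply (h : M.IsPair k x ξ) {s : Set ℝ} (hs : MeasurableSet s) :
    stepLaw k x ξ s = ENNReal.ofReal
      (∑ j ∈ Finset.range (k + 1), (ξ j - prevVal ξ j) * s.indicator 1 (x j)) := by
  rw [stepLaw, Measure.finsetSum_apply, ENNReal.ofReal_sum_of_nonneg]
  · refine Finset.sum_congr rfl fun j _ => ?_
    rw [Measure.smul_apply, Measure.dirac_apply' _ hs, smul_eq_mul]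
    by_cases hx : x j ∈ s <;> simp [hx]
  · intro j hj
    rw [Finset.mem_range] at hj
    exact mul_nonneg (sub_nonneg.2 (h.prevVal_le (by omega)))
      (indicator_nonneg (fun _ _ => zero_le_one) _)

lemma stepLaw_real_Icc (h : M.IsPair k x ξ) (t : ℝ) :
    (stepLaw k x ξ).real (Icc 0 t) = ∑ j ∈ Finset.range (k + 1),
      if x j ≤ t then ξ j - prevVal ξ j else 0 := by
  rw [Measure.real, h.stepLaw_apply measurableSet_Icc, ENNReal.toReal_ofReal]
  · refine Finset.sum_congr rfl fun j hj => ?_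
    rw [Finset.mem_range] at hj
    have := h.zero_le_x hj.le
    by_cases hx : x j ≤ t <;> simp [hx, this]
  · refine Finset.sum_nonneg fun j hj => ?_
    rw [Finset.mem_range] at hj
    exact mul_nonneg (sub_nonneg.2 (h.prevVal_le (by omega)))
      (indicator_nonneg (fun _ _ => zero_le_one) _)

lemma stepLaw_mem (h : M.IsPair k x ξ) : stepLaw k x ξ ∈ Pr01 := by
  constructor
  · constructor
    rw [h.stepLaw_apply MeasurableSet.univ]
    simp only [indicator_univ, Pi.one_apply, mul_one, sum_weights]
    simp [prevVal, h.ξ_k]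
  · rw [h.stepLaw_apply measurableSet_Icc.compl, Finset.sum_eq_zero]
    · simp
    · intro j hj
      rw [Finset.mem_range] at hj
      have h1 : x j ∈ Icc (0 : ℝ) 1 := ⟨h.zero_le_x hj.le, h.x_le_one hj.le⟩
      simp [h1.1, h1.2]

lemma le_stepLaw_real (h : M.IsPair k x ξ) {j : ℕ} (hj : j ≤ k) {t : ℝ} (ht : x j ≤ t) :
    ξ j ≤ (stepLaw k x ξ).real (Icc 0 t) := by
  have h1 : ξ j = ∑ i ∈ Finset.range (j + 1), (ξ i - prevVal ξ i) := by
    rw [sum_weights]; rfl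
  rw [h.stepLaw_real_Icc, h1]
  calc ∑ i ∈ Finset.range (j + 1), (ξ i - prevVal ξ i)
      = ∑ i ∈ Finset.range (j + 1), if x i ≤ t then ξ i - prevVal ξ i else 0 := by
        refine Finset.sum_congr rfl fun i hi => ?_
        rw [Finset.mem_range] at hi
        rw [if_pos ((h.x_mono (by omega : i ≤ j) (by omega)).trans ht)]
    _ ≤ _ := by
        refine Finset.sum_le_sum_of_subset_of_nonneg (Finset.range_mono (by omega)) ?_
        intro i hi _
        rw [Finset.mem_range] at hi
        split_ifs
        · exact sub_nonneg.2 (h.prevVal_le (by omega))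
        · exact le_rfl

lemma stepLaw_real_le (h : M.IsPair k x ξ) {j : ℕ} (hj : j ≤ k) {t : ℝ} (ht : t < x (j + 1)) :
    (stepLaw k x ξ).real (Icc 0 t) ≤ ξ j := by
  have h1 : ξ j = ∑ i ∈ Finset.range (j + 1), (ξ i - prevVal ξ i) := by
    rw [sum_weights]; rfl
  rw [h.stepLaw_real_Icc, h1,
    ← Finset.sum_subset (Finset.range_mono (by omega : j + 1 ≤ k + 1)) fun i hi hij => ?_]
  · refine Finset.sum_le_sum fun i hi => ?_
    rw [Finset.mem_range] at hi
    split_ifs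
    · exact le_rfl
    · exact sub_nonneg.2 (h.prevVal_le (by omega))
  · rw [Finset.mem_range] at hi hij
    exact if_neg (not_le.2 (ht.trans_le (h.x_mono (by omega) (by omega))))

lemma integral_stepLaw (h : M.IsPair k x ξ) {j : ℕ} (hj : j ≤ k + 1) :
    ∫ t in (x j)..1, (stepLaw k x ξ).real (Icc 0 t) =
      ∑ m ∈ Finset.Ico j (k + 1), ξ m * (x (m + 1) - x m) := by
  have hi : ∀ a b : ℝ,
      IntervalIntegrable (fun t => (stepLaw k x ξ).real (Icc 0 t)) volume a b := fun a b =>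
    (Pr01.mono h.stepLaw_mem).intervalIntegrable
  rw [← h.x_last, ← intervalIntegral.sum_integral_adjacent_intervals_Ico hj fun m _ => hi _ _]
  refine Finset.sum_congr rfl fun m hm => ?_
  rw [Finset.mem_Ico] at hm
  have hle : x m ≤ x (m + 1) := h.x_le m (by omega)
  have hval : ∀ t ∈ Ioo (x m) (x (m + 1)), (stepLaw k x ξ).real (Icc 0 t) = ξ m := fun t ht =>
    le_antisymm (h.stepLaw_real_le (by omega) ht.2) (h.le_stepLaw_real (by omega) ht.1.le)
  rw [intervalIntegral.integral_of_le hle, integral_Ioc_eq_integral_Ioo,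
    setIntegral_congr_fun measurableSet_Ioo hval, setIntegral_const,
    Real.volume_real_Ioo_of_le hle, smul_eq_mul, mul_comm]

/-- Weights may vanish, so x_j can exceed the quantile at ξ_j; the one-sided bound is what the limit
argument uses. -/
lemma quantile_stepLaw_le (h : M.IsPair k x ξ) {j : ℕ} (hj : j ≤ k) {p : ℝ} (hp : p ≤ ξ j) :
    quantile (stepLaw k x ξ) p ≤ x j :=
  (Pr01.quantile_le_iff h.stepLaw_mem (hp.trans (h.ξ_le_one (by omega)))
    ⟨h.zero_le_x (by omega), h.x_le_one (by omega)⟩).2 (hp.trans (h.le_stepLaw_real hj le_rfl))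

lemma le_quantile_stepLaw (h : M.IsPair k x ξ) {j : ℕ} (hj : j ≤ k) {p : ℝ} (hp : ξ j < p)
    (hp1 : p ≤ 1) : x (j + 1) ≤ quantile (stepLaw k x ξ) p := by
  by_contra! hlt
  have h1 := (Pr01.quantile_le_iff h.stepLaw_mem hp1
    ⟨quantile_nonneg _ _, Pr01.quantile_le_one h.stepLaw_mem hp1⟩).1 le_rfl
  linarith [h.stepLaw_real_le hj hlt]

/-- The first and the last index at which `ξ` takes the value `ζ_ℓ`. -/
lemma exists_index (h : M.IsPair k x ξ) {l : ℕ} (hl : 1 ≤ l) (hlr : l < M.r) :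
    ∃ i j, i + 1 ≤ j ∧ j < k ∧ ξ i < M.ζ l ∧ ξ (i + 1) = M.ζ l ∧ ξ j = M.ζ l ∧
      M.ζ l < ξ (j + 1) := by
  classical
  have hζ1 := M.ζ_lt_one hlr
  obtain ⟨m, hm, hml⟩ := h.ζ_mem l hlr.le
  have hmk : m < k := by
    by_contra hlt
    have := h.ξ_mono (show k ≤ m by omega) hm
    linarith [h.ξ_k]
  have hex : ∃ n, M.ζ l ≤ ξ n := ⟨m, hml.ge⟩
  have hex' : ∃ n, M.ζ l < ξ n := ⟨k, by rwa [h.ξ_k]⟩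
  have hspec := Nat.find_spec hex
  have hspec' := Nat.find_spec hex'
  have hfm : Nat.find hex ≤ m := Nat.find_min' hex hml.ge
  have hfk : Nat.find hex' ≤ k := Nat.find_min' hex' (by rwa [h.ξ_k])
  have hmf : m < Nat.find hex' := by
    by_contra hlt
    have := h.ξ_mono (show Nat.find hex' ≤ m by omega) hm
    linarith
  obtain ⟨m0, hm0, hm0l⟩ := h.ζ_mem 0 (Nat.zero_le _)
  -- ζ_0 < ζ_ℓ is itself a value of `ξ`, so the first index reaching ζ_ℓ has a predecessor; this is
  -- where ℓ ≥ 1 enters.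
  have hf0 : Nat.find hex ≠ 0 := fun h0 => by
    rw [h0] at hspec
    linarith [h.ξ_mono (Nat.zero_le m0) hm0, M.ζ_lt_of_lt (show 0 < l by omega) hlr.le]
  obtain ⟨i, hi⟩ := Nat.exists_eq_succ_of_ne_zero hf0
  obtain ⟨j, hj⟩ := Nat.exists_eq_succ_of_ne_zero (show Nat.find hex' ≠ 0 by omega)
  have hlow : ξ i < M.ζ l := not_le.1 (Nat.find_min hex (by omega : i < Nat.find hex))
  have hup : ξ j ≤ M.ζ l := not_lt.1 (Nat.find_min hex' (by omega : j < Nat.find hex'))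
  rw [hi] at hspec hfm
  rw [hj] at hspec' hfk hmf
  simp only [Nat.succ_eq_add_one] at *
  refine ⟨i, j, by omega, by omega, hlow, ?_, ?_, hspec'⟩
  · exact le_antisymm ((h.ξ_mono hfm hm).trans hml.le) hspec
  · exact le_antisymm hup (hml.ge.trans (h.ξ_mono (by omega) (by omega)))

end IsPair

end MultiscaleSK

/-! ### The support of the limit -/

/-- If the distribution function has a plateau at height `p`, then its end points belong to the
support and the open plateau has mass zero. -/
lemma support_gap {μ : Measure ℝ} (hμ : μ ∈ Pr01) {p : ℝ} (hp : p < 1)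
    (ha : 0 < quantile μ p) (hab : quantile μ p < quantileRight μ p) :
    quantile μ p ∈ μ.support ∧ quantileRight μ p ∈ μ.support ∧
      μ (Ioo (quantile μ p) (quantileRight μ p)) = 0 := by
  have := hμ.1
  set a := quantile μ p with hadef
  set b := quantileRight μ p with hbdef
  have hplat : ∀ t ∈ Ico a b, μ.real (Icc 0 t) = p := fun t ht =>
    Pr01.real_Icc_eq_of_mem hμ hp ht
  have hb1 : b ≤ 1 := Pr01.quantileRight_le_one hμ hp
  have hdiff : ∀ s t : ℝ, 0 ≤ s → s < t → μ.real (Icc 0 s) < μ.real (Icc 0 t) →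
      0 < μ (Ioc s t) := by
    intro s t hs hst hlt
    by_contra! h0
    have h1 : μ (Ioc s t) = 0 := le_antisymm h0 zero_le
    have h2 : μ (Icc 0 t) ≤ μ (Icc 0 s) := by
      rw [← Icc_union_Ioc_eq_Icc hs hst.le]
      exact (measure_union_le _ _).trans (by rw [h1, add_zero])
    exact absurd (ENNReal.toReal_mono (measure_ne_top _ _) h2) (not_le.2 hlt)
  have hsupp : ∀ c : ℝ, (∀ ε > 0, ∃ s t, c - ε < s ∧ t < c + ε ∧ 0 < μ (Ioc s t)) →
      c ∈ μ.support := by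
    intro c hc
    rw [Measure.mem_support_iff_forall]
    intro U hU
    obtain ⟨ε, hε, hεU⟩ := Metric.mem_nhds_iff.1 hU
    obtain ⟨s, t, hs, ht, hpos⟩ := hc ε hε
    refine hpos.trans_le (measure_mono fun v hv => hεU ?_)
    rw [Metric.mem_ball, Real.dist_eq, abs_lt]
    constructor <;> linarith [hv.1, hv.2]
  refine ⟨hsupp a fun ε hε => ?_, hsupp b fun ε hε => ?_, ?_⟩
  -- To the left of a the distribution function is below p, while at a it equals p, so mass lies
  -- just before a, or at a.
  · have hs : max 0 (a - ε / 2) < a := max_lt ha (by linarith)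
    refine ⟨max 0 (a - ε / 2), a, lt_of_lt_of_le (by linarith) (le_max_right _ _), by linarith,
      hdiff _ _ (le_max_left _ _) hs ?_⟩
    rw [hplat a ⟨le_rfl, hab⟩]
    by_contra! hle
    have := (Pr01.quantile_le_iff hμ hp.le (t := max 0 (a - ε / 2))
      ⟨le_max_left _ _, by linarith⟩).2 hle
    linarith
  -- The distribution function is still p just before b and at least q > p at the quantile of q,
  -- which lies in [b, b + ε/2).
  · obtain ⟨q, hq0, hq1, hq⟩ := Pr01.exists_quantile_lt hμ hp (show b < b + ε / 2 by linarith)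
    have hqb : b ≤ quantile μ q := Pr01.quantileRight_le hμ hq0 hq1
    have hs : max a (b - ε / 2) < b := max_lt hab (by linarith)
    refine ⟨max a (b - ε / 2), quantile μ q, lt_of_lt_of_le (by linarith) (le_max_right _ _),
      by linarith, hdiff _ _ (ha.le.trans (le_max_left _ _)) (hs.trans_le hqb) ?_⟩
    rw [hplat _ ⟨le_max_left _ _, hs⟩]
    exact hq0.trans_le ((Pr01.quantile_le_iff hμ hq1
      ⟨quantile_nonneg _ _, Pr01.quantile_le_one hμ hq1⟩).1 le_rfl)
  · have hsub : ∀ t ∈ Ico a b, μ (Ioc a t) = 0 := by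
      intro t ht
      by_contra h0
      have h1 : μ.real (Icc 0 t) = μ.real (Icc 0 a) + μ.real (Ioc a t) := by
        rw [← Icc_union_Ioc_eq_Icc ha.le ht.1]
        exact measureReal_union (disjoint_left.2 fun v hv hv' => absurd hv.2 (not_le.2 hv'.1))
          measurableSet_Ioc
      rw [hplat t ht, hplat a ⟨le_rfl, hab⟩] at h1
      exact h0 ((measureReal_eq_zero_iff).1 (by linarith))
    -- The gap is exhausted from inside, since b itself may be an atom.
    obtain ⟨u, -, hu, hut⟩ := exists_seq_strictMono_tendsto' hab
    have hU : Ioo a b ⊆ ⋃ n, Ioc a (u n) := fun v hv => by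
      obtain ⟨n, hn⟩ := (hut.eventually_const_lt hv.2).exists
      exact mem_iUnion.2 ⟨n, hv.1, hn.le⟩
    exact measure_mono_null hU (measure_iUnion_null fun n => hsub _ ⟨(hu n).1.le, (hu n).2⟩)

/-! ### The main theorem -/

theorem theorem6 (M : MultiscaleSK) (ℓ : ℕ) (hℓ : 1 ≤ ℓ) (hℓr : ℓ + 1 ≤ M.r)
    (hsmall : M.ζ ℓ * M.γ (ℓ + 1) ^ 2 < 1 / 2)
    (μ : Measure ℝ) (hμ : M.IsParisiMeasure μ)
    (k : ℕ → ℕ) (x ξ : ℕ → ℕ → ℝ)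
    (hstat : ∀ n, M.IsStationaryPair (k n) (x n) (ξ n))
    (hlim : Tendsto (fun n => W1 (stepLaw (k n) (x n) (ξ n)) μ) atTop (𝓝 0)) :
    -- lower bound on the quantile jump
    M.plateauBound ℓ μ ≤ M.quantileJump ℓ μ ∧
    -- plateau of the distribution function at height `ζ_ℓ`, of length the quantile jump
    (∀ t ∈ Ico (quantile μ (M.ζ ℓ)) (quantileRight μ (M.ζ ℓ)), μ.real (Icc 0 t) = M.ζ ℓ) ∧
    -- the lower bound is positive as soon as the two quantiles are not `0` and `1`
    (0 < quantile μ (M.ζ ℓ) → quantileRight μ (M.ζ ℓ) < 1 → 0 < M.plateauBound ℓ μ) ∧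
    -- and then the support has a gap
    (0 < M.plateauBound ℓ μ →
      quantile μ (M.ζ ℓ) < quantileRight μ (M.ζ ℓ) ∧
      quantile μ (M.ζ ℓ) ∈ μ.support ∧ quantileRight μ (M.ζ ℓ) ∈ μ.support ∧
      μ (Ioo (quantile μ (M.ζ ℓ)) (quantileRight μ (M.ζ ℓ))) = 0) := by
  have hμ' := hμ.1
  have hζ0 := M.ζ_pos (show ℓ ≤ M.r by omega)
  have hζ1 := M.ζ_lt_one (show ℓ < M.r by omega)
  have hγ : 0 < M.γ (ℓ + 1) ^ 2 - M.γ ℓ ^ 2 := by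
    have h1 := M.γ_lt ℓ (by omega)
    have h2 := M.γ_nonneg (show ℓ ≤ M.r by omega)
    nlinarith
  have ha0 : 0 ≤ quantile μ (M.ζ ℓ) := quantile_nonneg _ _
  have hab := Pr01.quantile_le_quantileRight hμ' hζ1
  have hb1 := Pr01.quantileRight_le_one hμ' hζ1
  have hpair : ∀ n, M.IsPair (k n) (x n) (ξ n) := fun n => (hstat n).1
  have hbound : M.plateauBound ℓ μ ≤ M.quantileJump ℓ μ := by
    choose i j hij hj hi hi1 hjl hj1 using
      fun n => (hpair n).exists_index hℓ (show ℓ < M.r by omega)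
    refine gap_of_tendsto_W1 hμ' hζ0 hζ1 (by positivity) (fun n => (hpair n).stepLaw_mem)
      (α := fun n => x n (i n + 1)) (β := fun n => x n (j n + 1)) (fun n => ?_) (fun n => ?_)
      (fun n p hp => ?_) (fun n p hp => ?_) (fun n => ?_) hlim
    · have := hij n; have := hj n
      exact (hpair n).zero_le_x (by omega)
    · have := hj n
      exact ⟨(hpair n).zero_le_x (by omega), (hpair n).x_le_one (by omega)⟩
    · have := hij n; have := hj n
      exact (hpair n).quantile_stepLaw_le (by omega) (by rw [hi1]; exact hp.2)
    · exact (hpair n).le_quantile_stepLaw (hj n).le (by rw [hjl]; exact hp.1) hp.2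
    · have := hj n
      rw [(hpair n).integral_stepLaw (by omega)]
      exact (hstat n).gap hℓ hℓr (hij n) (hj n) (hi n) (hi1 n) (hjl n) (hj1 n)
  refine ⟨hbound, fun t ht => Pr01.real_Icc_eq_of_mem hμ' hζ1 ht, fun ha hb => ?_, fun hC => ?_⟩
  · have hI : 0 < ∫ t in (quantileRight μ (M.ζ ℓ))..1, μ.real (Icc 0 t) := by
      -- To the right of b the distribution function is at least ζ_ℓ > 0.
      refine intervalIntegral.intervalIntegral_pos_of_pos_on
        (Pr01.mono hμ').intervalIntegrable (fun t ht => hζ0.trans_le ?_) hb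
      exact (Pr01.quantile_le_iff hμ' hζ1.le ⟨(ha0.trans hab).trans ht.1.le, ht.2.le⟩).1
        (hab.trans ht.1.le)
    unfold MultiscaleSK.plateauBound
    positivity
  · have hlt : quantile μ (M.ζ ℓ) < quantileRight μ (M.ζ ℓ) := sub_pos.1 (hC.trans_le hbound)
    have ha : 0 < quantile μ (M.ζ ℓ) := by
      -- The bound contains the quantile at ζ_ℓ as a factor, so it would vanish with it.
      refine ha0.lt_of_ne fun h0 => ?_
      rw [MultiscaleSK.plateauBound, ← h0] at hC
      simp at hC
    exact ⟨hlt, support_gap hμ' hζ1 ha hlt⟩
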